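/- For a set $A\subseteq\mathbb R^2$ let $A^c=\bigcap_{x\in A}B(x,1)$, where $B(x,1)$ is the closed Euclidean ball of radius $1$ centred at $x$, and let ${\rm conv}_c(A)=(A^c)^c$ be the $c$-hull of $A$, i.e. the intersection of all closed unit balls containing $A$ (this is $\mathbb R^2$ if no closed unit ball contains $A$). Let ${\rm Vol}$ denote Lebesgue measure on $\mathbb R^2$, with values in $[0,\infty]$. Let $v\in S^1$ be a unit vector. (i) Let $x_1,\dots,x_m\in\mathbb R^2$ and $\alpha_1,\dots,\alpha_m\in\mathbb R$, and for each $t\in\mathbb R$ let $L_t={\rm conv}_c\{x_i+t\alpha_i v: i=1,\dots,m\}$. Then the function $F(t)={\rm Vol}(L_t)$ is convex on $\mathbb R$. (ii) Let $A\subset\mathbb R^2$ be a bounded set and let $\alpha:A\to\mathbb R$ be an arbitrary function, and for each $t\in\mathbb R$ let $L_t={\rm conv}_c\{x+t\alpha(x)v: x\in A\}$. Then the function $F(t)={\rm Vol}(L_t)$ is convex on $\mathbb R$. In both parts convexity is that of a function with values in $[0,\infty]$: $F((1-\lambda)t_0+\lambda t_1)\le(1-\lambda)F(t_0)+\lambda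 F(t_1)$ for all $t_0,t_1\in\mathbb R$ and $\lambda\in[0,1]$, with $0\cdot\infty=0$. -/

import Mathlib

open scoped NNReal

/-- The `c`-dual of a set `A ⊆ ℝⁿ`: the intersection of all closed Euclidean unit balls centred at
points of `A`. -/
def cDual {n : ℕ} (A : Set (EuclideanSpace ℝ (Fin n))) : Set (EuclideanSpace ℝ (Fin n)) :=
  ⋂ x ∈ A, Metric.closedBall x 1

/-- The `c`-hull of a set `A ⊆ ℝⁿ`: the `c`-dual of its `c`-dual, i.e. the intersection of all
closed unit balls containing `A` (and the whole space if there is no such ball). -/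
def cHull {n : ℕ} (A : Set (EuclideanSpace ℝ (Fin n))) : Set (EuclideanSpace ℝ (Fin n)) :=
  cDual (cDual A)

open MeasureTheory ENNReal Filter Topology

/-! The `c`-hull of finitely many points is their convex hull with circular caps glued on along
chords, and the area of each piece is convex along the motion. For the convex hull this is the
classical shadow system argument (`volume_convexHull_midpoint`). The area of a cap is a
nonincreasing convex function of the distance from its chord to the centre, and that distance is a
concave function of the displacement between the endpoints (`capArea_midpoint`, `chordH_midpoint`).

The difficulty is that the pattern of caps changes with time. At a time `t`, redundant points are
discarded (`exists_minimal_config`). If two different closed unit balls contain the points, an open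
unit ball does, and hull plus caps bound the area from above (`volume_cHull_le`). The conditions on
the caps are then strict, so they persist at nearby times, where the corresponding pieces still sit
disjointly in the `c`-hull (`CapConfig.volume_le`). This lower bound is all that is needed at `t ±
ε`, and local midpoint convexity follows (`volume_cHull_local_midpoint`). With upper semicontinuity
(`eventually_volume_cHull_lt`), a maximum principle makes it global (`le_chord_of_local_midpoint`).

If at some interior time only one unit ball contains the points, averaging centres shows that the
same holds at both ends; the end hulls are then full unit discs and the inequality is trivial.
Infinite families reduce to finite ones by compactness (`volume_cHull_range_le`). -/

/-- The Euclidean plane. -/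
abbrev Plane := EuclideanSpace ℝ (Fin 2)

/-! ### Linear algebra of the plane in an orthonormal frame. -/

/-- Rotation by a right angle. -/
def rotJ (z : Plane) : Plane := !₂[-z 1, z 0]

@[simp] lemma rotJ_zero_coord (z : Plane) : rotJ z 0 = -z 1 := rfl
@[simp] lemma rotJ_one_coord (z : Plane) : rotJ z 1 = z 0 := rfl

lemma plane_ext {x y : Plane} (h0 : x 0 = y 0) (h1 : x 1 = y 1) : x = y := by
  ext i; fin_cases i <;> assumption

lemma plane_inner (x y : Plane) : inner ℝ x y = x 0 * y 0 + x 1 * y 1 := by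
  simp [PiLp.inner_apply, Fin.sum_univ_two, mul_comm]

lemma plane_norm_sq (x : Plane) : ‖x‖ ^ 2 = x 0 ^ 2 + x 1 ^ 2 := by
  rw [← real_inner_self_eq_norm_sq, plane_inner]; ring

lemma plane_norm_eq_one {x : Plane} : ‖x‖ = 1 ↔ x 0 ^ 2 + x 1 ^ 2 = 1 := by
  rw [← plane_norm_sq, pow_eq_one_iff_of_nonneg (norm_nonneg x) two_ne_zero]

lemma plane_norm_le_one {x : Plane} : ‖x‖ ≤ 1 ↔ x 0 ^ 2 + x 1 ^ 2 ≤ 1 := by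
  rw [← plane_norm_sq, sq_le_one_iff₀ (norm_nonneg x)]

lemma norm_rotJ (z : Plane) : ‖rotJ z‖ = ‖z‖ := by
  rw [← sq_eq_sq₀ (norm_nonneg _) (norm_nonneg _), plane_norm_sq, plane_norm_sq]
  simp; ring

lemma inner_rotJ_self (z : Plane) : inner ℝ (rotJ z) z = 0 := by
  rw [plane_inner]; simp; ring

lemma rotJ_rotJ (z : Plane) : rotJ (rotJ z) = -z := by
  apply plane_ext <;> simp

lemma rotJ_smul (k : ℝ) (z : Plane) : rotJ (k • z) = k • rotJ z := by
  apply plane_ext <;> simp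

lemma rotJ_neg (z : Plane) : rotJ (-z) = -rotJ z := by
  apply plane_ext <;> simp

lemma plane_decomp {n : Plane} (hn : ‖n‖ = 1) (z : Plane) :
    z = (inner ℝ z n : ℝ) • n + (inner ℝ z (rotJ n) : ℝ) • rotJ n := by
  rw [plane_norm_eq_one] at hn
  apply plane_ext
  · simp only [plane_inner, PiLp.add_apply, PiLp.smul_apply, smul_eq_mul, rotJ_zero_coord,
      rotJ_one_coord]
    linear_combination (-z 0) * hn
  · simp only [plane_inner, PiLp.add_apply, PiLp.smul_apply, smul_eq_mul, rotJ_zero_coord,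
      rotJ_one_coord]
    linear_combination (-z 1) * hn

lemma plane_norm_sq_decomp {n : Plane} (hn : ‖n‖ = 1) (z : Plane) :
    ‖z‖ ^ 2 = (inner ℝ z n : ℝ) ^ 2 + (inner ℝ z (rotJ n) : ℝ) ^ 2 := by
  rw [plane_norm_eq_one] at hn
  simp only [plane_norm_sq, plane_inner, rotJ_zero_coord, rotJ_one_coord]
  linear_combination (-(z 0 ^ 2 + z 1 ^ 2)) * hn

lemma mem_segment_chord {n Y : Plane} {h r : ℝ} (hn : ‖n‖ = 1) (hr : 0 < r)
    (hhr : h ^ 2 + r ^ 2 = 1) (hY : ‖Y‖ ≤ 1) (hYn : inner ℝ Y n = h) :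
    Y ∈ segment ℝ (h • n - r • rotJ n) (h • n + r • rotJ n) := by
  have h1 := plane_norm_sq_decomp hn Y
  have h2 : ‖Y‖ ^ 2 ≤ 1 := by nlinarith [norm_nonneg Y]
  have h3 := plane_decomp hn Y
  rw [hYn] at h1 h3
  set τ : ℝ := inner ℝ Y (rotJ n)
  have hτ : |τ| ≤ r := abs_le_of_sq_le_sq (by nlinarith) hr.le
  obtain ⟨h4, h5⟩ := abs_le.1 hτ
  refine ⟨(r - τ) / (2 * r), (r + τ) / (2 * r), by apply div_nonneg <;> linarith,
    by apply div_nonneg <;> linarith, by field_simp; ring, ?_⟩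
  rw [h3]
  have e1 : (r - τ) / (2 * r) + (r + τ) / (2 * r) = 1 := by field_simp; ring
  have e2 : (r + τ) / (2 * r) * r - (r - τ) / (2 * r) * r = τ := by field_simp; ring
  calc _ = ((r - τ) / (2 * r) + (r + τ) / (2 * r)) • h • n +
        ((r + τ) / (2 * r) * r - (r - τ) / (2 * r) * r) • rotJ n := by module
    _ = _ := by rw [e1, e2, one_smul]

/-- Shrinking `Z` towards the centre down to height `h` keeps it in the disc, so it lands on the
chord. -/
lemma exists_ray_segment {n Z : Plane} {h r : ℝ} (hn : ‖n‖ = 1) (hr : 0 < r) (hh : 0 < h)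
    (hhr : h ^ 2 + r ^ 2 = 1) (hZ : ‖Z‖ ≤ 1) (hZn : h ≤ inner ℝ Z n) :
    ∃ Y ∈ segment ℝ (h • n - r • rotJ n) (h • n + r • rotJ n),
      Y = (h / inner ℝ Z n) • Z := by
  refine ⟨_, mem_segment_chord hn hr hhr ?_ ?_, rfl⟩
  · rw [norm_smul, Real.norm_of_nonneg (div_nonneg hh.le (hh.le.trans hZn))]
    exact mul_le_one₀ (div_le_one_of_le₀ hZn (by linarith)) (norm_nonneg _) hZ
  · rw [inner_smul_left]
    have : (inner ℝ Z n : ℝ) ≠ 0 := by linarith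
    simp only [conj_trivial]
    field_simp

/-! ### Chords of unit circles and their caps. -/

/-- The half length of the chord from `p` to `q`. -/
noncomputable def chordR (p q : Plane) : ℝ := ‖q - p‖ / 2

/-- The distance from the chord from `p` to `q` to the centre of a unit circle through `p`, `q`. -/
noncomputable def chordH (p q : Plane) : ℝ := √(1 - chordR p q ^ 2)

/-- The unit normal to the chord from `p` to `q`, pointing to its right. -/
noncomputable def chordN (p q : Plane) : Plane := -(‖q - p‖⁻¹ • rotJ (q - p))

/-- The centre, to the left of the chord, of a unit circle through `p` and `q`. -/
noncomputable def chordC (p q : Plane) : Plane := (1 / 2 : ℝ) • (p + q) - chordH p q • chordN p q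

/-- The part to the right of the chord of the unit disc centred at `chordC p q`. -/
def cap (p q : Plane) : Set Plane :=
  {z | ‖z - chordC p q‖ ≤ 1 ∧ chordH p q < inner ℝ (z - chordC p q) (chordN p q)}

section chord

variable {p q : Plane}

lemma chordR_pos (hpq : p ≠ q) : 0 < chordR p q := by
  have := norm_pos_iff.2 (sub_ne_zero.2 hpq.symm)
  unfold chordR; linarith

lemma chordR_lt_one (h2 : ‖q - p‖ < 2) : chordR p q < 1 := by
  unfold chordR; linarith

lemma chordH_pos (h2 : ‖q - p‖ < 2) : 0 < chordH p q := by
  apply Real.sqrt_pos.2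
  have h1 := chordR_lt_one h2
  have : 0 ≤ chordR p q := by unfold chordR; positivity
  nlinarith

lemma chordH_sq (h2 : ‖q - p‖ < 2) : chordH p q ^ 2 + chordR p q ^ 2 = 1 := by
  unfold chordH
  rw [Real.sq_sqrt]
  · ring
  · have h1 := chordR_lt_one h2
    have : 0 ≤ chordR p q := by unfold chordR; positivity
    nlinarith

lemma norm_chordN (hpq : p ≠ q) : ‖chordN p q‖ = 1 := by
  have := norm_pos_iff.2 (sub_ne_zero.2 hpq.symm)
  unfold chordN
  rw [norm_neg, norm_smul, norm_rotJ, norm_inv, norm_norm]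
  field_simp

lemma chordR_smul_rotJ (hpq : p ≠ q) :
    chordR p q • rotJ (chordN p q) = (1 / 2 : ℝ) • (q - p) := by
  have := norm_pos_iff.2 (sub_ne_zero.2 hpq.symm)
  unfold chordN chordR
  rw [rotJ_neg, rotJ_smul, rotJ_rotJ, smul_neg, smul_neg, smul_neg, neg_neg, smul_smul]
  congr 1
  field_simp

lemma sub_chordC_left (hpq : p ≠ q) :
    p - chordC p q = chordH p q • chordN p q - chordR p q • rotJ (chordN p q) := by
  rw [chordR_smul_rotJ hpq, chordC]; module

lemma sub_chordC_right (hpq : p ≠ q) :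
    q - chordC p q = chordH p q • chordN p q + chordR p q • rotJ (chordN p q) := by
  rw [chordR_smul_rotJ hpq, chordC]; module

lemma inner_sub_chordC_left (hpq : p ≠ q) :
    inner ℝ (p - chordC p q) (chordN p q) = chordH p q := by
  rw [sub_chordC_left hpq, inner_sub_left, inner_smul_left, inner_smul_left, inner_rotJ_self,
    real_inner_self_eq_norm_sq, norm_chordN hpq]
  simp

lemma inner_sub_chordC_right (hpq : p ≠ q) :
    inner ℝ (q - chordC p q) (chordN p q) = chordH p q := by
  rw [sub_chordC_right hpq, inner_add_left, inner_smul_left, inner_smul_left, inner_rotJ_self,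
    real_inner_self_eq_norm_sq, norm_chordN hpq]
  simp

lemma norm_sub_chordC_left (hpq : p ≠ q) (h2 : ‖q - p‖ < 2) : ‖p - chordC p q‖ = 1 := by
  have hn := plane_norm_eq_one.1 (norm_chordN hpq)
  rw [sub_chordC_left hpq, plane_norm_eq_one]
  simp
  linear_combination (chordH p q ^ 2 + chordR p q ^ 2) * hn + chordH_sq h2

lemma norm_sub_chordC_right (hpq : p ≠ q) (h2 : ‖q - p‖ < 2) : ‖q - chordC p q‖ = 1 := by
  have hn := plane_norm_eq_one.1 (norm_chordN hpq)
  rw [sub_chordC_right hpq, plane_norm_eq_one]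
  simp
  linear_combination (chordH p q ^ 2 + chordR p q ^ 2) * hn + chordH_sq h2

lemma chordR_comm (p q : Plane) : chordR q p = chordR p q := by
  unfold chordR; rw [norm_sub_rev]

lemma chordH_comm (p q : Plane) : chordH q p = chordH p q := by
  unfold chordH; rw [chordR_comm]

lemma chordN_comm (p q : Plane) : chordN q p = -chordN p q := by
  unfold chordN
  rw [norm_sub_rev, ← neg_sub q p, rotJ_neg, smul_neg]

lemma chordC_comm (p q : Plane) :
    chordC q p = (1 / 2 : ℝ) • (p + q) + chordH p q • chordN p q := by
  rw [chordC, chordH_comm, chordN_comm, add_comm q p, smul_neg, sub_neg_eq_add]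

lemma chordC_ne_comm (hpq : p ≠ q) (h2 : ‖q - p‖ < 2) : chordC p q ≠ chordC q p := by
  intro h
  rw [chordC_comm, chordC, sub_eq_add_neg, add_left_cancel_iff] at h
  replace h : (2 : ℝ) • chordH q p • chordN q p = 0 := by
    rw [two_smul]; nth_rewrite 1 [h]; simp
  replace h := (smul_eq_zero.1 h).resolve_left two_ne_zero
  have h0 := norm_chordN hpq.symm
  rcases smul_eq_zero.1 h with h | h
  · exact (chordH_pos (by rwa [norm_sub_rev])).ne' h
  · simp [h] at h0

/-- Equal distances make the vector from `c` to the midpoint orthogonal to the chord; Pythagoras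
then leaves its length, hence two signs. -/
lemma eq_chordC_or (hpq : p ≠ q) (h2 : ‖q - p‖ < 2) {c : Plane} (hp : ‖p - c‖ = 1)
    (hq : ‖q - c‖ = 1) : c = chordC p q ∨ c = chordC q p := by
  set n := chordN p q with hn
  have hn1 : ‖n‖ = 1 := norm_chordN hpq
  have hr := chordR_pos hpq
  set d : Plane := (1 / 2 : ℝ) • (p + q) - c with hd
  have e1 : p - c = d - chordR p q • rotJ n := by rw [hn, chordR_smul_rotJ hpq, hd]; module
  have e2 : q - c = d + chordR p q • rotJ n := by rw [hn, chordR_smul_rotJ hpq, hd]; module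
  have h3 := norm_sub_sq_real d (chordR p q • rotJ n)
  have h4 := norm_add_sq_real d (chordR p q • rotJ n)
  rw [← e1, hp] at h3
  rw [← e2, hq] at h4
  rw [inner_smul_right] at h3 h4
  rw [norm_smul, norm_rotJ, hn1, Real.norm_of_nonneg hr.le] at h3 h4
  have h5 : inner ℝ d (rotJ n) = (0 : ℝ) := by
    have : chordR p q * inner ℝ d (rotJ n) = 0 := by linarith
    exact (mul_eq_zero.1 this).resolve_left hr.ne'
  have h6 := plane_norm_sq_decomp hn1 d
  have h7 := plane_decomp hn1 d
  rw [h5] at h3 h6 h7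
  have h8 := chordH_sq h2
  have h9 : (inner ℝ d n - chordH p q) * (inner ℝ d n + chordH p q) = (0 : ℝ) := by
    nlinarith
  have hc : c = (1 / 2 : ℝ) • (p + q) - d := by rw [hd]; module
  rcases mul_eq_zero.1 h9 with h | h
  · left
    rw [hc, chordC, ← hn, h7, sub_eq_zero.1 h]; simp
  · right
    rw [hc, chordC_comm, ← hn, h7, eq_neg_of_add_eq_zero_left h]; simp

/-- Seen from the centre, the closed cap lies in the cone over the chord, beyond the chord. This
form makes linear inequalities at the endpoints pass to the cap. -/
lemma exists_ray_chord (hpq : p ≠ q) (h2 : ‖q - p‖ < 2) {z : Plane}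
    (hz : ‖z - chordC p q‖ ≤ 1) (hzn : chordH p q ≤ inner ℝ (z - chordC p q) (chordN p q)) :
    ∃ k : ℝ, 1 ≤ k ∧ (chordH p q < inner ℝ (z - chordC p q) (chordN p q) → 1 < k) ∧
      ∃ a b : ℝ, 0 ≤ a ∧ 0 ≤ b ∧ a + b = 1 ∧
        z - chordC p q = k • (a • (p - chordC p q) + b • (q - chordC p q)) := by
  obtain ⟨Y, ⟨a, b, ha, hb, hab, hY⟩, hYz⟩ := exists_ray_segment (norm_chordN hpq)
    (chordR_pos hpq) (chordH_pos h2) (chordH_sq h2) hz hzn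
  have hh := chordH_pos h2
  refine ⟨inner ℝ (z - chordC p q) (chordN p q) / chordH p q, (one_le_div hh).2 hzn,
    fun h => (one_lt_div hh).2 h, a, b, ha, hb, hab, ?_⟩
  rw [sub_chordC_left hpq, sub_chordC_right hpq, hY, hYz, smul_smul]
  have : (inner ℝ (z - chordC p q) (chordN p q) : ℝ) ≠ 0 := by linarith
  rw [div_mul_div_cancel₀ hh.ne', div_self this, one_smul]

end chord

/-! ### Caps inside `c`-hulls, disjointness of caps, cocircular points. -/

lemma mem_cDual {n : ℕ} {A : Set (EuclideanSpace ℝ (Fin n))} {d : EuclideanSpace ℝ (Fin n)} :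
    d ∈ cDual A ↔ ∀ a ∈ A, ‖a - d‖ ≤ 1 := by
  simp [cDual, dist_eq_norm, norm_sub_rev]

lemma mem_cHull {n : ℕ} {A : Set (EuclideanSpace ℝ (Fin n))} {z : EuclideanSpace ℝ (Fin n)} :
    z ∈ cHull A ↔ ∀ d, (∀ a ∈ A, ‖a - d‖ ≤ 1) → ‖z - d‖ ≤ 1 := by
  simp only [cHull, mem_cDual, norm_sub_rev z]

lemma cHull_mono {n : ℕ} {A B : Set (EuclideanSpace ℝ (Fin n))} (h : A ⊆ B) :
    cHull A ⊆ cHull B := fun _ hz => mem_cHull.2 fun d hd =>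
  mem_cHull.1 hz d fun a ha => hd a (h ha)

/-- For a unit vector `P`, `‖P - D‖ ≤ 1` means `⟪P, D⟫ ≥ ‖D‖ ^ 2 / 2`. This linear inequality
survives convex combinations and factors `k ≥ 1`, and with `‖Z‖ ≤ 1` it gives the norm bound back.
-/
lemma norm_sub_le_one_of_cone {P Q Z D : Plane} {a b k : ℝ} (hP : ‖P‖ = 1) (hQ : ‖Q‖ = 1)
    (ha : 0 ≤ a) (hb : 0 ≤ b) (hab : a + b = 1) (hk : 1 ≤ k)
    (hZ : Z = k • (a • P + b • Q)) (hZ1 : ‖Z‖ ≤ 1) (hPD : ‖P - D‖ ≤ 1) (hQD : ‖Q - D‖ ≤ 1) :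
    ‖Z - D‖ ≤ 1 := by
  have h1 := norm_sub_sq_real P D
  have h2 := norm_sub_sq_real Q D
  have h3 := norm_sub_sq_real Z D
  have h4 : inner ℝ Z D = k * (a * inner ℝ P D + b * inner ℝ Q D) := by
    rw [hZ]; simp only [inner_smul_left, inner_add_left, conj_trivial]
  have h5 : ‖P - D‖ ^ 2 ≤ 1 := pow_le_one₀ (norm_nonneg _) hPD
  have h6 : ‖Q - D‖ ^ 2 ≤ 1 := pow_le_one₀ (norm_nonneg _) hQD
  have h7 : ‖Z‖ ^ 2 ≤ 1 := pow_le_one₀ (norm_nonneg _) hZ1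
  have h8 : ‖D‖ ^ 2 / 2 ≤ inner ℝ P D := by nlinarith
  have h9 : ‖D‖ ^ 2 / 2 ≤ inner ℝ Q D := by nlinarith
  have h10 : ‖D‖ ^ 2 / 2 ≤ a * inner ℝ P D + b * inner ℝ Q D := by
    have e1 := mul_le_mul_of_nonneg_left h8 ha
    have e2 := mul_le_mul_of_nonneg_left h9 hb
    have e3 : ‖D‖ ^ 2 / 2 = a * (‖D‖ ^ 2 / 2) + b * (‖D‖ ^ 2 / 2) := by
      rw [← add_mul, hab, one_mul]
    linarith
  have h11 : ‖D‖ ^ 2 / 2 ≤ inner ℝ Z D := by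
    rw [h4]; nlinarith [sq_nonneg ‖D‖]
  rw [← sq_le_one_iff₀ (norm_nonneg _)]
  linarith

lemma closedCap_subset_cHull {p q : Plane} (hpq : p ≠ q) (h2 : ‖q - p‖ < 2) {z : Plane}
    (hz : ‖z - chordC p q‖ ≤ 1) (hzn : chordH p q ≤ inner ℝ (z - chordC p q) (chordN p q)) :
    z ∈ cHull {p, q} := by
  obtain ⟨k, hk, -, a, b, ha, hb, hab, hZ⟩ := exists_ray_chord hpq h2 hz hzn
  refine mem_cHull.2 fun d hd => ?_
  have := norm_sub_le_one_of_cone (D := d - chordC p q) (norm_sub_chordC_left hpq h2)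
    (norm_sub_chordC_right hpq h2) ha hb hab hk hZ hz
    (by simpa using hd p (by simp)) (by simpa using hd q (by simp))
  simpa using this

lemma cap_subset_cHull {p q : Plane} (hpq : p ≠ q) (h2 : ‖q - p‖ < 2) :
    cap p q ⊆ cHull {p, q} :=
  fun _ hz => closedCap_subset_cHull hpq h2 hz.1 hz.2.le

/-- The linear inequality of `norm_sub_le_one_of_cone` becomes strict because `k > 1` in an open cap
and `D ≠ 0`. -/
lemma cap_bisector {p q c : Plane} (hpq : p ≠ q) (h2 : ‖q - p‖ < 2) (hc : chordC p q ≠ c)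
    (hp : ‖p - c‖ ≤ 1) (hq : ‖q - c‖ ≤ 1) {z : Plane} (hz : z ∈ cap p q) :
    ‖z - c‖ < ‖z - chordC p q‖ := by
  obtain ⟨k, -, hk, a, b, ha, hb, hab, hZ⟩ := exists_ray_chord hpq h2 hz.1 hz.2.le
  specialize hk hz.2
  set D := c - chordC p q with hD
  have hD0 : 0 < ‖D‖ := norm_pos_iff.2 (sub_ne_zero.2 hc.symm)
  have e : ∀ w : Plane, w - c = (w - chordC p q) - D := fun w => by rw [hD]; module
  rw [e] at hp hq ⊢
  have h1 := norm_sub_sq_real (p - chordC p q) D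
  have h3 := norm_sub_sq_real (q - chordC p q) D
  have h4 := norm_sub_sq_real (z - chordC p q) D
  rw [norm_sub_chordC_left hpq h2] at h1
  rw [norm_sub_chordC_right hpq h2] at h3
  have h5 : ‖p - chordC p q - D‖ ^ 2 ≤ 1 := pow_le_one₀ (norm_nonneg _) hp
  have h6 : ‖q - chordC p q - D‖ ^ 2 ≤ 1 := pow_le_one₀ (norm_nonneg _) hq
  have h7 : inner ℝ (z - chordC p q) D =
      k * (a * inner ℝ (p - chordC p q) D + b * inner ℝ (q - chordC p q) D) := by
    rw [hZ]; simp only [inner_smul_left, inner_add_left, conj_trivial]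
  have h8 : ‖D‖ ^ 2 / 2 ≤ inner ℝ (p - chordC p q) D := by nlinarith
  have h9 : ‖D‖ ^ 2 / 2 ≤ inner ℝ (q - chordC p q) D := by nlinarith
  have h10 : ‖D‖ ^ 2 / 2 ≤
      a * inner ℝ (p - chordC p q) D + b * inner ℝ (q - chordC p q) D := by
    have e1 := mul_le_mul_of_nonneg_left h8 ha
    have e2 := mul_le_mul_of_nonneg_left h9 hb
    have e3 : ‖D‖ ^ 2 / 2 = a * (‖D‖ ^ 2 / 2) + b * (‖D‖ ^ 2 / 2) := by
      rw [← add_mul, hab, one_mul]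
    linarith
  have h11 : ‖D‖ ^ 2 / 2 < inner ℝ (z - chordC p q) D := by
    rw [h7]
    have : 0 < ‖D‖ ^ 2 / 2 := by positivity
    nlinarith
  rw [← sq_lt_sq₀ (norm_nonneg _) (norm_nonneg _)]
  linarith

/-- A common point would be strictly nearer to each of the two centres than to the other. -/
lemma cap_disjoint {p q r s : Plane} (hpq : p ≠ q) (h2 : ‖q - p‖ < 2) (hrs : r ≠ s)
    (h2' : ‖s - r‖ < 2) (hc : chordC p q ≠ chordC r s)
    (hp : ‖p - chordC r s‖ ≤ 1) (hq : ‖q - chordC r s‖ ≤ 1)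
    (hr : ‖r - chordC p q‖ ≤ 1) (hs : ‖s - chordC p q‖ ≤ 1) :
    Disjoint (cap p q) (cap r s) := by
  rw [Set.disjoint_left]
  intro z hz hz'
  exact lt_asymm (cap_bisector hpq h2 hc hp hq hz) (cap_bisector hrs h2' hc.symm hr hs hz')

lemma measurableSet_cap (p q : Plane) : MeasurableSet (cap p q) := by
  apply MeasurableSet.inter
  · exact (isClosed_le (f := fun z => ‖z - chordC p q‖) (by fun_prop)
      continuous_const).measurableSet
  · exact (isOpen_lt (g := fun z => inner ℝ (z - chordC p q) (chordN p q)) continuous_const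
      (by fun_prop)).measurableSet

/-- One of three points of a unit circle, all in an open half plane through the centre, lies in the
`c`-hull of the two others. -/
lemma mem_cHull_of_relation {c p q r : Plane} (hp : ‖p - c‖ = 1) (hq : ‖q - c‖ = 1)
    (hr : ‖r - c‖ = 1) {a b : ℝ} (ha : 0 ≤ a) (hb : 0 ≤ b)
    (h : r - c = a • (p - c) + b • (q - c)) : r ∈ cHull {p, q} := by
  have hab : 1 ≤ a + b := by
    have := norm_add_le (a • (p - c)) (b • (q - c))
    rw [← h, hr, norm_smul, norm_smul, hp, hq, Real.norm_of_nonneg ha, Real.norm_of_nonneg hb]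
      at this
    linarith
  have h0 : a + b ≠ 0 := by linarith
  refine mem_cHull.2 fun d hd => ?_
  have := norm_sub_le_one_of_cone (a := a / (a + b)) (b := b / (a + b)) (D := d - c) hp hq
    (by positivity) (by positivity) (by field_simp) hab (Z := r - c)
    (by rw [h, smul_add, smul_smul, smul_smul, mul_div_cancel₀ _ h0, mul_div_cancel₀ _ h0]) hr.le
    (by simpa using hd p (by simp)) (by simpa using hd q (by simp))
  simpa using this

lemma exists_relation (P Q R : Plane) :
    ∃ a b k : ℝ, (a ≠ 0 ∨ b ≠ 0 ∨ k ≠ 0) ∧ a • P + b • Q + k • R = 0 := by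
  by_cases h : P 0 * Q 1 - P 1 * Q 0 = 0 ∧ Q 0 * R 1 - Q 1 * R 0 = 0 ∧ R 0 * P 1 - R 1 * P 0 = 0
  · by_cases hP : P = 0
    · exact ⟨1, 0, 0, by simp, by simp [hP]⟩
    · have hP' : ¬ (P 0 = 0 ∧ P 1 = 0) := fun h0 => hP (plane_ext h0.1 h0.2)
      rw [not_and_or] at hP'
      rcases hP' with h1 | h1
      · refine ⟨-Q 0, P 0, 0, by tauto, plane_ext ?_ ?_⟩ <;> simp <;> linarith [h.1]
      · refine ⟨-Q 1, P 1, 0, by tauto, plane_ext ?_ ?_⟩ <;> simp <;> linarith [h.1]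
  · refine ⟨Q 0 * R 1 - Q 1 * R 0, R 0 * P 1 - R 1 * P 0, P 0 * Q 1 - P 1 * Q 0, by tauto,
      plane_ext ?_ ?_⟩ <;> simp <;> ring

/-- A linear relation between three vectors of an open half plane has coefficients of mixed sign. Up
to a global sign exactly one is negative, and solving for that vector puts it in the cone of the
other two. -/
lemma three_cocircular {c p q r u : Plane} (hp : ‖p - c‖ = 1) (hq : ‖q - c‖ = 1)
    (hr : ‖r - c‖ = 1) (hpu : 0 < inner ℝ (p - c) u) (hqu : 0 < inner ℝ (q - c) u)
    (hru : 0 < inner ℝ (r - c) u) :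
    p ∈ cHull {q, r} ∨ q ∈ cHull {p, r} ∨ r ∈ cHull {p, q} := by
  have key : ∀ {p q r : Plane}, ‖p - c‖ = 1 → ‖q - c‖ = 1 → ‖r - c‖ = 1 → ∀ {a b k : ℝ},
      0 ≤ a → 0 ≤ b → k < 0 → a • (p - c) + b • (q - c) + k • (r - c) = 0 →
      r ∈ cHull {p, q} := by
    intro p q r hp hq hr a b k ha hb hk h
    refine mem_cHull_of_relation hp hq hr (a := a / -k) (b := b / -k)
      (div_nonneg ha (by linarith)) (div_nonneg hb (by linarith)) ?_
    have h1 : (-k) • (r - c) = a • (p - c) + b • (q - c) := by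
      rw [neg_smul, eq_comm, ← sub_eq_zero, sub_neg_eq_add, h]
    rw [div_eq_inv_mul, div_eq_inv_mul, ← smul_smul, ← smul_smul, ← smul_add, ← h1, smul_smul,
      inv_mul_cancel₀ (by linarith), one_smul]
  obtain ⟨a, b, k, h0, h⟩ := exists_relation (p - c) (q - c) (r - c)
  have hs := congrArg (fun w => inner ℝ w u) h
  simp only [inner_add_left, inner_smul_left, conj_trivial, inner_zero_left] at hs
  have h' : (-a) • (p - c) + (-b) • (q - c) + (-k) • (r - c) = 0 := by
    rw [← neg_zero, ← h]; module
  have r1 : ∀ {a b k : ℝ}, a • (p - c) + b • (q - c) + k • (r - c) = 0 →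
      a • (p - c) + k • (r - c) + b • (q - c) = 0 := fun h => by rw [← h]; module
  have r2 : ∀ {a b k : ℝ}, a • (p - c) + b • (q - c) + k • (r - c) = 0 →
      b • (q - c) + k • (r - c) + a • (p - c) = 0 := fun h => by rw [← h]; module
  rcases le_or_gt 0 a with ha | ha <;> rcases le_or_gt 0 b with hb | hb <;>
    rcases le_or_gt 0 k with hk | hk
  · exfalso
    have e1 := mul_nonneg ha hpu.le
    have e2 := mul_nonneg hb hqu.le
    have e3 := mul_nonneg hk hru.le
    have f1 : a = 0 := (mul_eq_zero.1 (by linarith : a * inner ℝ (p - c) u = 0)).resolve_right hpu.ne'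
    have f2 : b = 0 := (mul_eq_zero.1 (by linarith : b * inner ℝ (q - c) u = 0)).resolve_right hqu.ne'
    have f3 : k = 0 := (mul_eq_zero.1 (by linarith : k * inner ℝ (r - c) u = 0)).resolve_right hru.ne'
    tauto
  · exact .inr (.inr (key hp hq hr ha hb hk h))
  · exact .inr (.inl (key hp hr hq ha hk hb (r1 h)))
  · exact .inl (key hq hr hp (by linarith) (by linarith)
      (by
        rcases ha.lt_or_eq with ha | ha
        · linarith
        · exfalso
          rw [← ha] at hs
          nlinarith [mul_pos (neg_pos.2 hb) hqu, mul_pos (neg_pos.2 hk) hru]) (r2 h'))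
  · exact .inl (key hq hr hp hb hk ha (r2 h))
  · exact .inr (.inl (key hp hr hq (by linarith) (by linarith)
      (by
        rcases hb.lt_or_eq with hb | hb
        · linarith
        · exfalso
          rw [← hb] at hs
          nlinarith [mul_pos (neg_pos.2 ha) hpu, mul_pos (neg_pos.2 hk) hru]) (r1 h')))
  · exact .inr (.inr (key hp hq hr (by linarith) (by linarith)
      (by
        rcases hk.lt_or_eq with hk | hk
        · linarith
        · exfalso
          rw [← hk] at hs
          nlinarith [mul_pos (neg_pos.2 ha) hpu, mul_pos (neg_pos.2 hb) hqu]) h'))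
  · exfalso
    nlinarith [mul_pos (neg_pos.2 ha) hpu, mul_pos (neg_pos.2 hb) hqu, mul_pos (neg_pos.2 hk) hru]

/-! ### Areas by slicing: caps and convex hulls. -/

/-- The linear isometry of the plane given by the orthonormal frame `rotJ v`, `v`. -/
noncomputable def frameIsometry (v : Plane) (hv : ‖v‖ = 1) : Plane ≃ₗᵢ[ℝ] Plane :=
  LinearIsometry.toLinearIsometryEquiv
    { toFun := fun w => w 0 • rotJ v + w 1 • v
      map_add' := fun a b => by simp only [PiLp.add_apply]; module
      map_smul' := fun k a => by simp only [PiLp.smul_apply, smul_eq_mul, RingHom.id_apply]; module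
      norm_map' := fun w => by
        have hn := plane_norm_eq_one.1 hv
        rw [← sq_eq_sq₀ (norm_nonneg _) (norm_nonneg _), plane_norm_sq, plane_norm_sq]
        simp
        linear_combination (w 0 ^ 2 + w 1 ^ 2) * hn } rfl

lemma volume_eq_lintegral_slice {v : Plane} (hv : ‖v‖ = 1) {K : Set Plane}
    (hK : MeasurableSet K) :
    volume K = ∫⁻ y : ℝ, volume {s : ℝ | y • rotJ v + s • v ∈ K} := by
  have h1 : MeasurePreserving (frameIsometry v hv) :=
    LinearIsometryEquiv.measurePreserving _
  have h2 : MeasurePreserving (fun z : ℝ × ℝ => frameIsometry v hv (!₂[z.1, z.2])) :=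
    h1.comp ((PiLp.volume_preserving_toLp (Fin 2)).comp
      ((volume_preserving_finTwoArrow ℝ).symm MeasurableEquiv.finTwoArrow))
  rw [← h2.measure_preimage hK.nullMeasurableSet, Measure.volume_eq_prod,
    Measure.prod_apply (h2.measurable hK)]
  rfl

/-- The area of the part of the unit disc above height `h`. -/
noncomputable def capArea (h : ℝ) : ℝ≥0∞ := ∫⁻ y : ℝ, ENNReal.ofReal (√(1 - y ^ 2) - h)

lemma volume_cap {p q : Plane} (hpq : p ≠ q) (h2 : ‖q - p‖ < 2) :
    volume (cap p q) = capArea (chordH p q) := by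
  set n := chordN p q with hndef
  have hn : ‖n‖ = 1 := norm_chordN hpq
  have hn' := plane_norm_eq_one.1 hn
  have hh := chordH_pos h2
  rw [← measure_preimage_add_right volume (chordC p q),
    volume_eq_lintegral_slice hn ((measurable_add_const _) (measurableSet_cap p q)), capArea]
  congr 1
  funext y
  have e : {s : ℝ | y • rotJ n + s • n ∈ (fun z => z + chordC p q) ⁻¹' cap p q} =
      {s : ℝ | y ^ 2 + s ^ 2 ≤ 1 ∧ chordH p q < s} := by
    ext s
    have e1 : ‖y • rotJ n + s • n‖ ≤ 1 ↔ y ^ 2 + s ^ 2 ≤ 1 := by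
      rw [plane_norm_le_one]
      have : (y • rotJ n + s • n) 0 ^ 2 + (y • rotJ n + s • n) 1 ^ 2 = y ^ 2 + s ^ 2 := by
        simp
        linear_combination (y ^ 2 + s ^ 2) * hn'
      rw [this]
    have e2 : inner ℝ (y • rotJ n + s • n) n = s := by
      rw [inner_add_left, inner_smul_left, inner_smul_left, inner_rotJ_self,
        real_inner_self_eq_norm_sq, hn]
      simp
    simp only [cap, Set.mem_ofPred_eq, Set.mem_preimage, add_sub_cancel_right, ← hndef, e1, e2]
  -- For `|y| > 1` the root takes the default value `0 < chordH p q`, and both sides are empty.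
  have e' : {s : ℝ | y ^ 2 + s ^ 2 ≤ 1 ∧ chordH p q < s} =
      Set.Ioc (chordH p q) (√(1 - y ^ 2)) := by
    ext s
    simp only [Set.mem_ofPred_eq, Set.mem_Ioc]
    constructor
    · rintro ⟨a, b⟩
      exact ⟨b, Real.le_sqrt_of_sq_le (by linarith)⟩
    · rintro ⟨a, b⟩
      have := (Real.le_sqrt' (hh.trans a)).1 b
      exact ⟨by linarith, a⟩
  rw [e, e', Real.volume_Ioc]

/-- The integrand is the positive part of an affine decreasing function of `h`, hence convex and
nonincreasing in `h`. -/
lemma capArea_midpoint {h a b : ℝ} (hab : a + b ≤ 2 * h) :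
    2 * capArea h ≤ capArea a + capArea b := by
  unfold capArea
  rw [← lintegral_const_mul _ (by fun_prop), ← lintegral_add_left (by fun_prop)]
  refine lintegral_mono fun y => ?_
  rw [← ENNReal.ofReal_ofNat 2, ← ENNReal.ofReal_mul (by norm_num)]
  exact (ENNReal.ofReal_le_ofReal (by linarith)).trans ENNReal.ofReal_add_le

/-- The norm is convex, and `s ↦ √(1 - s ^ 2)` is concave and decreasing on `[0, 1]`. -/
lemma chordH_midpoint {p q u : Plane} (h1 : ‖(q + u) - p‖ < 2) (h2 : ‖(q - u) - p‖ < 2) :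
    √(1 - (‖q + u - p‖ / 2) ^ 2) + √(1 - (‖q - u - p‖ / 2) ^ 2) ≤
      2 * √(1 - (‖q - p‖ / 2) ^ 2) := by
  set a : ℝ := ‖q + u - p‖ / 2
  set b : ℝ := ‖q - u - p‖ / 2
  set c : ℝ := ‖q - p‖ / 2
  have ha : 0 ≤ a := by positivity
  have hb : 0 ≤ b := by positivity
  have hc : 0 ≤ c := by positivity
  have hc' : 2 * c ≤ a + b := by
    have := norm_add_le (q + u - p) (q - u - p)
    have e : (q + u - p) + (q - u - p) = (2 : ℝ) • (q - p) := by module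
    rw [e, norm_smul] at this
    norm_num at this
    simp only [a, b, c]; linarith
  have ha1 : a < 1 := by simp only [a]; linarith
  have hb1 : b < 1 := by simp only [b]; linarith
  have s1 := Real.sq_sqrt (show 0 ≤ 1 - a ^ 2 by nlinarith)
  have s2 := Real.sq_sqrt (show 0 ≤ 1 - b ^ 2 by nlinarith)
  have h3 : ((√(1 - a ^ 2) + √(1 - b ^ 2)) / 2) ≤ √(1 - c ^ 2) := by
    apply Real.le_sqrt_of_sq_le
    nlinarith [sq_nonneg (√(1 - a ^ 2) - √(1 - b ^ 2)), sq_nonneg (a - b)]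
  linarith

lemma volume_convexHull_midpoint {ι : Type*} (S : Finset ι) (x : ι → Plane) (β : ι → ℝ)
    {v : Plane} (hv : ‖v‖ = 1) :
    2 * volume (convexHull ℝ (x '' S)) ≤
      volume (convexHull ℝ ((fun i => x i + β i • v) '' S)) +
        volume (convexHull ℝ ((fun i => x i - β i • v) '' S)) := by
  set K := convexHull ℝ (x '' (S : Set ι))
  set K₁ := convexHull ℝ ((fun i => x i + β i • v) '' (S : Set ι))
  set K₂ := convexHull ℝ ((fun i => x i - β i • v) '' (S : Set ι))
  have hK : IsCompact K := (S.finite_toSet.image _).isCompact_convexHull ℝ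
  have hK₁ : IsCompact K₁ := (S.finite_toSet.image _).isCompact_convexHull ℝ
  have hK₂ : IsCompact K₂ := (S.finite_toSet.image _).isCompact_convexHull ℝ
  -- The points admitting a common shift `b` form a convex set that contains the generators of `K`.
  -- Applied at both ends of a slice, the shifts cancel when the lengths of the two moved slices are
  -- added.
  have lift : ∀ z ∈ K, ∃ b : ℝ, z + b • v ∈ K₁ ∧ z - b • v ∈ K₂ := by
    have hc : Convex ℝ {z : Plane | ∃ b : ℝ, z + b • v ∈ K₁ ∧ z - b • v ∈ K₂} := by
      rintro z ⟨b, h1, h2⟩ z' ⟨b', h1', h2'⟩ s t hs ht hst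
      refine ⟨s * b + t * b', ?_, ?_⟩
      · convert convex_convexHull ℝ _ h1 h1' hs ht hst using 1; module
      · convert convex_convexHull ℝ _ h2 h2' hs ht hst using 1; module
    apply convexHull_min _ hc
    rintro _ ⟨i, hi, rfl⟩
    exact ⟨β i, subset_convexHull ℝ _ ⟨i, hi, rfl⟩, subset_convexHull ℝ _ ⟨i, hi, rfl⟩⟩
  rw [volume_eq_lintegral_slice hv hK.measurableSet,
    volume_eq_lintegral_slice hv hK₁.measurableSet, volume_eq_lintegral_slice hv hK₂.measurableSet]
  have hmeas : ∀ {K : Set Plane}, IsCompact K →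
      Measurable fun y : ℝ => volume {s : ℝ | y • rotJ v + s • v ∈ K} := by
    intro K hK
    exact measurable_measure_prodMk_left (ν := (volume : Measure ℝ))
      (s := {z : ℝ × ℝ | z.1 • rotJ v + z.2 • v ∈ K})
      (hK.isClosed.preimage (by fun_prop)).measurableSet
  rw [← lintegral_const_mul _ (hmeas hK), ← lintegral_add_left (hmeas hK₁)]
  refine lintegral_mono fun y => ?_
  set w := y • rotJ v
  have hT : IsCompact {s : ℝ | w + s • v ∈ K} := by
    have : Isometry fun s : ℝ => w + s • v := Isometry.of_dist_eq fun s t => by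
      rw [dist_add_left, dist_eq_norm, ← sub_smul, norm_smul, hv, mul_one, dist_eq_norm]
    exact this.isClosedEmbedding.isCompact_preimage hK
  have hconv : ∀ {K : Set Plane} {a b : ℝ}, Convex ℝ K → w + a • v ∈ K → w + b • v ∈ K →
      ENNReal.ofReal (b - a) ≤ volume {s : ℝ | w + s • v ∈ K} := by
    intro K a b hK ha hb
    rw [← Real.volume_Icc]
    refine measure_mono fun s hs => ?_
    rcases hs.1.trans hs.2 |>.lt_or_eq with hab | rfl
    · have hba : b - a ≠ 0 := by linarith
      have := hK ha hb (a := (b - s) / (b - a)) (b := (s - a) / (b - a))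
        (div_nonneg (by linarith [hs.2]) (by linarith)) (div_nonneg (by linarith [hs.1])
          (by linarith)) (by field_simp; ring)
      have e1 : (b - s) / (b - a) + (s - a) / (b - a) = 1 := by field_simp; ring
      have e2 : (b - s) / (b - a) * a + (s - a) / (b - a) * b = s := by field_simp; ring
      have e : ((b - s) / (b - a)) • (w + a • v) + ((s - a) / (b - a)) • (w + b • v) =
        ((b - s) / (b - a) + (s - a) / (b - a)) • w +
          ((b - s) / (b - a) * a + (s - a) / (b - a) * b) • v := by module
      rw [e, e1, e2, one_smul] at this
      exact this
    · have : s = a := le_antisymm hs.2 hs.1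
      simpa [this] using ha
  rcases Set.eq_empty_or_nonempty {s : ℝ | w + s • v ∈ K} with he | hne
  · simp [he]
  have hu := hT.sSup_mem hne
  have hl := hT.sInf_mem hne
  set u := sSup {s : ℝ | w + s • v ∈ K}
  set l := sInf {s : ℝ | w + s • v ∈ K}
  obtain ⟨b, hb1, hb2⟩ := lift _ hu
  obtain ⟨b', hb1', hb2'⟩ := lift _ hl
  have i1 := hconv (K := K₁) (a := l + b') (b := u + b) (convex_convexHull ℝ _)
    (by convert hb1' using 1; module) (by convert hb1 using 1; module)
  have i2 := hconv (K := K₂) (a := l - b') (b := u - b) (convex_convexHull ℝ _)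
    (by convert hb2' using 1; module) (by convert hb2 using 1; module)
  have i0 : volume {s : ℝ | w + s • v ∈ K} ≤ ENNReal.ofReal (u - l) := by
    rw [← Real.volume_Icc]
    exact measure_mono fun s hs => ⟨csInf_le hT.bddBelow hs, le_csSup hT.bddAbove hs⟩
  calc 2 * volume {s : ℝ | w + s • v ∈ K} ≤ 2 * ENNReal.ofReal (u - l) := by gcongr
    _ = ENNReal.ofReal (2 * (u - l)) := by
      rw [ENNReal.ofReal_mul (by norm_num), ENNReal.ofReal_ofNat]
    _ = ENNReal.ofReal ((u + b - (l + b')) + (u - b - (l - b'))) := by congr 1; ring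
    _ ≤ _ := ENNReal.ofReal_add_le.trans (add_le_add i1 i2)

/-! ### Elementary properties of `c`-duality. -/

lemma isClosed_cDual {n : ℕ} (A : Set (EuclideanSpace ℝ (Fin n))) : IsClosed (cDual A) :=
  isClosed_biInter fun _ _ => Metric.isClosed_closedBall

lemma convex_cDual {n : ℕ} (A : Set (EuclideanSpace ℝ (Fin n))) : Convex ℝ (cDual A) :=
  convex_iInter₂ fun _ _ => convex_closedBall _ _

lemma cDual_subset_closedBall {n : ℕ} {A : Set (EuclideanSpace ℝ (Fin n))}
    {a : EuclideanSpace ℝ (Fin n)} (ha : a ∈ A) : cDual A ⊆ Metric.closedBall a 1 :=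
  Set.biInter_subset_of_mem ha

lemma isCompact_cDual {n : ℕ} {A : Set (EuclideanSpace ℝ (Fin n))} (hA : A.Nonempty) :
    IsCompact (cDual A) :=
  (isCompact_closedBall _ _).of_isClosed_subset (isClosed_cDual A)
    (cDual_subset_closedBall hA.some_mem)

lemma subset_cHull {n : ℕ} (A : Set (EuclideanSpace ℝ (Fin n))) : A ⊆ cHull A :=
  fun a ha => mem_cHull.2 fun _ hd => hd a ha

lemma convexHull_subset_cHull {n : ℕ} (A : Set (EuclideanSpace ℝ (Fin n))) :
    convexHull ℝ A ⊆ cHull A :=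
  convexHull_min (subset_cHull A) (convex_cDual _)

lemma cHull_subset_closedBall {n : ℕ} {A : Set (EuclideanSpace ℝ (Fin n))}
    {d : EuclideanSpace ℝ (Fin n)} (hd : d ∈ cDual A) : cHull A ⊆ Metric.closedBall d 1 :=
  cDual_subset_closedBall hd

/-- If two different closed unit balls contain `A`, then an open unit ball does. -/
lemma exists_norm_sub_lt_one {A : Set Plane} {d d' : Plane} (hd : d ∈ cDual A)
    (hd' : d' ∈ cDual A) (hne : d ≠ d') : ∃ m, ∀ a ∈ A, ‖a - m‖ < 1 := by
  refine ⟨(1 / 2 : ℝ) • (d + d'), fun a ha => ?_⟩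
  have h1 := mem_cDual.1 hd a ha
  have h2 := mem_cDual.1 hd' a ha
  have h3 := parallelogram_law_with_norm ℝ (a - d) (a - d')
  have e1 : (a - d) + (a - d') = (2 : ℝ) • (a - (1 / 2 : ℝ) • (d + d')) := by module
  have e2 : (a - d) - (a - d') = d' - d := by module
  rw [e1, e2, norm_smul, Real.norm_ofNat] at h3
  have h4 : 0 < ‖d' - d‖ := norm_pos_iff.2 (sub_ne_zero.2 hne.symm)
  rw [← sq_lt_one_iff₀ (norm_nonneg _)]
  nlinarith [norm_nonneg (a - d), norm_nonneg (a - d')]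

/-! ### Cap configurations: stability and the lower area bound. -/

section config

variable {ι : Type*}

/-- The chords `e ∈ E` join points of the configuration `X` of points indexed by `S`, and all other
points lie strictly inside the unit disc cut by the chord, strictly to its left. -/
def CapConfig (S : Finset ι) (E : Finset (ι × ι)) (X : ι → Plane) : Prop :=
  ∀ e ∈ E, e.1 ∈ S ∧ e.2 ∈ S ∧ X e.1 ≠ X e.2 ∧ ‖X e.2 - X e.1‖ < 2 ∧
    ∀ k ∈ S, k ≠ e.1 → k ≠ e.2 → ‖X k - chordC (X e.1) (X e.2)‖ < 1 ∧
      inner ℝ (X k - chordC (X e.1) (X e.2)) (chordN (X e.1) (X e.2)) < chordH (X e.1) (X e.2)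

variable {S : Finset ι} {E : Finset (ι × ι)} {X : ι → Plane}

lemma CapConfig.norm_sub_le (h : CapConfig S E X) {e : ι × ι} (he : e ∈ E) {k : ι}
    (hk : k ∈ S) : ‖X k - chordC (X e.1) (X e.2)‖ ≤ 1 := by
  obtain ⟨-, -, hne, h2, H⟩ := h e he
  by_cases h1 : k = e.1
  · rw [h1]; exact (norm_sub_chordC_left hne h2).le
  by_cases h1' : k = e.2
  · rw [h1']; exact (norm_sub_chordC_right hne h2).le
  exact (H k hk h1 h1').1.le

lemma CapConfig.inner_le (h : CapConfig S E X) {e : ι × ι} (he : e ∈ E) {k : ι}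
    (hk : k ∈ S) : inner ℝ (X k - chordC (X e.1) (X e.2)) (chordN (X e.1) (X e.2)) ≤
      chordH (X e.1) (X e.2) := by
  obtain ⟨-, -, hne, h2, H⟩ := h e he
  by_cases h1 : k = e.1
  · rw [h1]; exact (inner_sub_chordC_left hne).le
  by_cases h1' : k = e.2
  · rw [h1']; exact (inner_sub_chordC_right hne).le
  exact (H k hk h1 h1').2.le

/-- Equal centres would put the endpoints of `f` on the circle of `e`, where the only points are the
endpoints of `e`. So `f` would be `e` reversed, whose centre lies on the other side of the chord. -/
lemma CapConfig.chordC_ne (h : CapConfig S E X) {e f : ι × ι} (he : e ∈ E) (hf : f ∈ E)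
    (hef : e ≠ f) : chordC (X e.1) (X e.2) ≠ chordC (X f.1) (X f.2) := by
  intro hc
  obtain ⟨-, -, hne, h2, H⟩ := h e he
  obtain ⟨hf1, hf2, hnf, h2', -⟩ := h f hf
  have a1 : f.1 = e.1 ∨ f.1 = e.2 := by
    by_contra! hcon
    have := (H f.1 hf1 hcon.1 hcon.2).1
    rw [hc, norm_sub_chordC_left hnf h2'] at this
    exact lt_irrefl _ this
  have a2 : f.2 = e.1 ∨ f.2 = e.2 := by
    by_contra! hcon
    have := (H f.2 hf2 hcon.1 hcon.2).1
    rw [hc, norm_sub_chordC_right hnf h2'] at this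
    exact lt_irrefl _ this
  rcases a1 with a1 | a1 <;> rcases a2 with a2 | a2
  · exact hnf (by rw [a1, a2])
  · exact hef (Prod.ext a1.symm a2.symm)
  · rw [a1, a2] at hc
    exact chordC_ne_comm hne h2 hc
  · exact hnf (by rw [a1, a2])

/-- The caps are pairwise disjoint, and each is separated by its chord from the convex hull. -/
lemma CapConfig.volume_le (h : CapConfig S E X) :
    volume (convexHull ℝ (X '' S)) + ∑ e ∈ E, capArea (chordH (X e.1) (X e.2)) ≤
      volume (cHull (X '' S)) := by
  have e1 : ∑ e ∈ E, capArea (chordH (X e.1) (X e.2)) =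
      volume (⋃ e ∈ E, cap (X e.1) (X e.2)) := by
    rw [measure_biUnion_finset]
    · refine Finset.sum_congr rfl fun e he => ?_
      obtain ⟨-, -, hne, h2, -⟩ := h e he
      rw [volume_cap hne h2]
    · intro e he f hf hef
      obtain ⟨he1, he2, hne, h2, -⟩ := h e he
      obtain ⟨hf1, hf2, hnf, h2', -⟩ := h f hf
      exact cap_disjoint hne h2 hnf h2' (h.chordC_ne he hf hef) (h.norm_sub_le hf he1)
        (h.norm_sub_le hf he2) (h.norm_sub_le he hf1) (h.norm_sub_le he hf2)
    · exact fun e _ => measurableSet_cap _ _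
  rw [e1, ← measure_union _ (Finset.measurableSet_biUnion _ fun e _ => measurableSet_cap _ _)]
  · refine measure_mono (Set.union_subset (convexHull_subset_cHull _) ?_)
    refine Set.iUnion₂_subset fun e he => ?_
    obtain ⟨he1, he2, hne, h2, -⟩ := h e he
    refine (cap_subset_cHull hne h2).trans (cHull_mono ?_)
    rintro _ (rfl | rfl)
    exacts [⟨_, he1, rfl⟩, ⟨_, he2, rfl⟩]
  · rw [Set.disjoint_iUnion₂_right]
    intro e he
    have hsub : convexHull ℝ (X '' S) ⊆
        {z | inner ℝ (chordN (X e.1) (X e.2)) z ≤ chordH (X e.1) (X e.2) +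
          inner ℝ (chordN (X e.1) (X e.2)) (chordC (X e.1) (X e.2))} := by
      apply convexHull_min
      · rintro _ ⟨k, hk, rfl⟩
        have := h.inner_le he hk
        rw [real_inner_comm, inner_sub_right] at this
        simpa using this
      · exact convex_halfSpace_le (innerₛₗ ℝ (chordN (X e.1) (X e.2))).isLinear _
    rw [Set.disjoint_left]
    intro z hz hz'
    have h1 := hsub hz
    have h2 := hz'.2
    rw [real_inner_comm, inner_sub_right] at h2
    simp only [Set.mem_ofPred_eq] at h1
    linarith

lemma ContinuousAt.chord {T : Type*} [TopologicalSpace T] {p q : T → Plane} {t : T}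
    (hp : ContinuousAt p t) (hq : ContinuousAt q t) (hne : p t ≠ q t) :
    ContinuousAt (fun s => chordH (p s) (q s)) t ∧ ContinuousAt (fun s => chordN (p s) (q s)) t ∧
      ContinuousAt (fun s => chordC (p s) (q s)) t := by
  have h1 : ContinuousAt (fun s => chordH (p s) (q s)) t := by
    unfold chordH chordR; fun_prop
  have h2 : ContinuousAt (fun s => chordN (p s) (q s)) t := by
    unfold chordN
    have hJ : ContinuousAt (fun s => rotJ (q s - p s)) t := by
      unfold rotJ; fun_prop
    have h0 : ‖q t - p t‖ ≠ 0 := norm_ne_zero_iff.2 (sub_ne_zero.2 hne.symm)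
    have hI : ContinuousAt (fun s => ‖q s - p s‖⁻¹) t := by fun_prop (disch := assumption)
    exact (hI.smul hJ).neg
  have h3 : ContinuousAt (fun s => chordC (p s) (q s)) t := by
    unfold chordC; fun_prop
  exact ⟨h1, h2, h3⟩

/-- The conditions that depend on position are finitely many strict inequalities between quantities
continuous where the endpoints differ. -/
lemma CapConfig.eventually {T : Type*} [TopologicalSpace T] {X : T → ι → Plane} {t : T}
    (hX : ∀ i, ContinuousAt (fun s => X s i) t) (h : CapConfig S E (X t)) :
    ∀ᶠ s in 𝓝 t, CapConfig S E (X s) := by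
  unfold CapConfig
  rw [eventually_all_finset]
  intro e he
  obtain ⟨he1, he2, hne, h2, H⟩ := h e he
  obtain ⟨c1, c2, c3⟩ := ContinuousAt.chord (hX e.1) (hX e.2) hne
  have a1 : ∀ᶠ s in 𝓝 t, X s e.1 ≠ X s e.2 :=
    (((hX e.1).sub (hX e.2)).eventually_ne (sub_ne_zero.2 hne)).mono fun _ => sub_ne_zero.1
  have a2 : ∀ᶠ s in 𝓝 t, ‖X s e.2 - X s e.1‖ < 2 :=
    ((hX e.2).sub (hX e.1)).norm.eventually_lt continuousAt_const h2
  have a3 : ∀ᶠ s in 𝓝 t, ∀ k ∈ S, k ≠ e.1 → k ≠ e.2 →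
      ‖X s k - chordC (X s e.1) (X s e.2)‖ < 1 ∧
      inner ℝ (X s k - chordC (X s e.1) (X s e.2)) (chordN (X s e.1) (X s e.2)) <
        chordH (X s e.1) (X s e.2) := by
    rw [eventually_all_finset]
    intro k hk
    by_cases hk1 : k = e.1
    · simp [hk1]
    by_cases hk2 : k = e.2
    · simp [hk2]
    obtain ⟨b1, b2⟩ := H k hk hk1 hk2
    filter_upwards [((hX k).sub c3).norm.eventually_lt continuousAt_const b1,
      (((hX k).sub c3).inner c2).eventually_lt c1 b2] with s h1 h2 _ _ using ⟨h1, h2⟩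
  filter_upwards [a1, a2, a3] with s h1 h2 h3 using ⟨he1, he2, h1, h2, h3⟩

/-! ### The hull of an irredundant configuration is covered by the convex hull and the caps. -/

/-- If `z` were not beyond the chord, the segment from `z - chordC p q` to `ν` would meet the chord.
The meeting point is at least as high as `z` in direction `ν`, while the chord's endpoints are
strictly lower. -/
lemma mem_cap_of_mem_cone {p q z ν : Plane} (hpq : p ≠ q) (h2 : ‖q - p‖ < 2) (hν : ‖ν‖ = 1)
    {a b : ℝ} (ha : 0 ≤ a) (hb : 0 ≤ b)
    (hab : ν = a • (p - chordC p q) + b • (q - chordC p q)) (hz : ‖z - chordC p q‖ ≤ 1)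
    (hpz : (inner ℝ p ν : ℝ) < inner ℝ z ν) (hqz : (inner ℝ q ν : ℝ) < inner ℝ z ν) :
    z ∈ cap p q := by
  refine ⟨hz, ?_⟩
  by_contra! hcon
  have hn := norm_chordN hpq
  have hP := norm_sub_chordC_left hpq h2
  have hQ := norm_sub_chordC_right hpq h2
  have hh := chordH_pos h2
  have hab1 : 1 ≤ a + b := by
    have := norm_add_le (a • (p - chordC p q)) (b • (q - chordC p q))
    rw [← hab, hν, norm_smul, norm_smul, hP, hQ, Real.norm_of_nonneg ha,
      Real.norm_of_nonneg hb] at this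
    linarith
  have hνn : chordH p q ≤ inner ℝ ν (chordN p q) := by
    rw [hab, inner_add_left, inner_smul_left, inner_smul_left, inner_sub_chordC_left hpq,
      inner_sub_chordC_right hpq]
    simp only [conj_trivial]
    nlinarith
  obtain ⟨τ, hτ0, hτ1, hτ⟩ : ∃ τ : ℝ, 0 ≤ τ ∧ τ ≤ 1 ∧
      (1 - τ) * inner ℝ (z - chordC p q) (chordN p q) + τ * inner ℝ ν (chordN p q) =
        chordH p q := by
    set s : ℝ := inner ℝ (z - chordC p q) (chordN p q)
    set w : ℝ := inner ℝ ν (chordN p q)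
    rcases (hcon.trans hνn).lt_or_eq with h | h
    · have : w - s ≠ 0 := by linarith
      refine ⟨(chordH p q - s) / (w - s), div_nonneg (by linarith) (by linarith),
        div_le_one_of_le₀ (by linarith) (by linarith), ?_⟩
      field_simp; ring
    · exact ⟨0, le_rfl, zero_le_one, by linarith⟩
  obtain ⟨x, y, hx, hy, hxy, hY⟩ := mem_segment_chord hn (chordR_pos hpq) (chordH_sq h2)
    (Y := (1 - τ) • (z - chordC p q) + τ • ν)
    (by
      refine (norm_add_le _ _).trans ?_
      rw [norm_smul, norm_smul, hν, Real.norm_of_nonneg hτ0,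
        Real.norm_of_nonneg (by linarith : 0 ≤ 1 - τ)]
      nlinarith)
    (by simpa [inner_add_left, inner_smul_left] using hτ)
  rw [← sub_chordC_left hpq, ← sub_chordC_right hpq] at hY
  have h3 := congrArg (fun w => inner ℝ w ν) hY
  simp only [inner_add_left, inner_smul_left, inner_sub_left, conj_trivial,
    real_inner_self_eq_norm_sq, hν] at h3
  have h4 : (inner ℝ z ν : ℝ) - inner ℝ (chordC p q) ν ≤ 1 := by
    rw [← inner_sub_left]
    exact (real_inner_le_norm _ _).trans (by rw [hν, mul_one]; exact hz)
  have h5 : x * (inner ℝ p ν - inner ℝ (chordC p q) ν) +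
      y * (inner ℝ q ν - inner ℝ (chordC p q) ν) <
      inner ℝ z ν - inner ℝ (chordC p q) ν := by
    have hy' : y = 1 - x := by linarith
    subst hy'
    rcases hx.lt_or_eq with hx | hx
    · nlinarith [mul_lt_mul_of_pos_left hpz hx, mul_le_mul_of_nonneg_left hqz.le hy]
    · rw [← hx]; linarith
  nlinarith

lemma mem_cone_of_dual {P Q ν : Plane} (hD : P 0 * Q 1 - P 1 * Q 0 ≠ 0)
    (h : ∀ d : Plane, 0 < inner ℝ d P → 0 < inner ℝ d Q → 0 ≤ (inner ℝ d ν : ℝ)) :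
    ∃ a b : ℝ, 0 ≤ a ∧ 0 ≤ b ∧ ν = a • P + b • Q := by
  set D := P 0 * Q 1 - P 1 * Q 0 with hDdef
  set a := (ν 0 * Q 1 - ν 1 * Q 0) / D with ha
  set b := (P 0 * ν 1 - P 1 * ν 0) / D with hb
  have hν : ν = a • P + b • Q := by
    apply plane_ext
    · simp [ha, hb]; field_simp; rw [hDdef]; ring
    · simp [ha, hb]; field_simp; rw [hDdef]; ring
  have key : ∀ A B : ℝ, 0 < A → 0 < B → 0 ≤ a * A + b * B := by
    intro A B hA hB
    set d : Plane := !₂[(A * Q 1 - B * P 1) / D, (B * P 0 - A * Q 0) / D]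
    have d0 : d 0 = (A * Q 1 - B * P 1) / D := rfl
    have d1 : d 1 = (B * P 0 - A * Q 0) / D := rfl
    have e1 : inner ℝ d P = A := by
      rw [plane_inner, d0, d1]; field_simp; rw [hDdef]; ring
    have e2 : inner ℝ d Q = B := by
      rw [plane_inner, d0, d1]; field_simp; rw [hDdef]; ring
    have := h d (by rwa [e1]) (by rwa [e2])
    rw [hν, inner_add_right, inner_smul_right, inner_smul_right, e1, e2] at this
    exact this
  refine ⟨a, b, ?_, ?_, hν⟩
  · by_contra! hlt
    -- A large first product makes `a * A + b * B` equal to `-(|b| + 1) + b < 0`.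
    have := key ((|b| + 1) / -a) 1 (div_pos (by positivity) (by linarith)) one_pos
    have e : a * ((|b| + 1) / -a) = -(|b| + 1) := by rw [div_neg, mul_neg, mul_div_cancel₀ _ hlt.ne]
    linarith [le_abs_self b]
  · by_contra! hlt
    have := key 1 ((|a| + 1) / -b) one_pos (div_pos (by positivity) (by linarith))
    have e : b * ((|a| + 1) / -b) = -(|a| + 1) := by rw [div_neg, mul_neg, mul_div_cancel₀ _ hlt.ne]
    linarith [le_abs_self a]

/-- First order optimality for a linear function minimized over an intersection of unit discs. -/
lemma inner_nonneg_of_isMinOn {c ν d : Plane} (hc : c ∈ cDual (X '' S))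
    (hmin : IsMinOn (fun w => (inner ℝ w ν : ℝ)) (cDual (X '' S)) c)
    (hd : ∀ k ∈ S, ‖X k - c‖ = 1 → 0 < (inner ℝ d (X k - c) : ℝ)) : 0 ≤ (inner ℝ d ν : ℝ) := by
  -- A small step along `d` stays in the dual: inactive constraints by continuity, active ones
  -- because `‖X k - c - ε • d‖ ^ 2 = 1 - 2 * ε * ⟪d, X k - c⟫ + ε ^ 2 * ‖d‖ ^ 2`.
  have hf : ∀ᶠ ε : ℝ in 𝓝[>] 0, ∀ k ∈ S, ‖X k - (c + ε • d)‖ ≤ 1 := by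
    rw [eventually_all_finset]
    intro k hk
    have hk1 := mem_cDual.1 hc _ ⟨k, hk, rfl⟩
    rcases hk1.lt_or_eq with h | h
    · have hcont : ContinuousAt (fun ε : ℝ => ‖X k - (c + ε • d)‖) 0 := by fun_prop
      have := hcont.eventually_lt (continuousAt_const (y := (1 : ℝ))) (by simpa using h)
      filter_upwards [this.filter_mono nhdsWithin_le_nhds] with ε hε using hε.le
    · have hd' := hd k hk h
      have hcont : ContinuousAt (fun ε : ℝ => ε * ‖d‖ ^ 2) 0 := by fun_prop
      have := hcont.eventually_lt (continuousAt_const (y := (2 * inner ℝ d (X k - c) : ℝ)))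
        (by simpa using hd')
      filter_upwards [this.filter_mono nhdsWithin_le_nhds, self_mem_nhdsWithin] with ε hε hε0
      have hε0 : 0 < ε := hε0
      have e : X k - (c + ε • d) = (X k - c) - ε • d := by module
      have h3 := norm_sub_sq_real (X k - c) (ε • d)
      rw [inner_smul_right, norm_smul, Real.norm_of_nonneg hε0.le, h, real_inner_comm] at h3
      rw [e, ← sq_le_one_iff₀ (norm_nonneg _), h3]
      nlinarith
  obtain ⟨ε, hε, hε0⟩ := (hf.and self_mem_nhdsWithin).exists
  have hε0 : 0 < ε := hε0
  have := hmin (a := c + ε • d) (mem_cDual.2 (by rintro _ ⟨k, hk, rfl⟩; exact hε k hk))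
  simp only [Set.mem_ofPred_eq, inner_add_left, inner_smul_left, conj_trivial] at this
  by_contra! hneg
  nlinarith

lemma not_mem_cHull_pair (hmin : ∀ k ∈ S, X k ∉ cHull (X '' (S \ {k} : Set ι))) {a b k : ι}
    (ha : a ∈ S) (hb : b ∈ S) (hk : k ∈ S) (hak : a ≠ k) (hbk : b ≠ k) :
    X k ∉ cHull {X a, X b} := fun h => hmin k hk (cHull_mono (by
  rintro _ (rfl | rfl)
  exacts [⟨a, ⟨ha, hak⟩, rfl⟩, ⟨b, ⟨hb, hbk⟩, rfl⟩]) h)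

/-- The open unit ball about `m` forces all points on the circle about `c` into the open half plane
in direction `m - c`, so `three_cocircular` contradicts irredundancy. -/
lemma three_not_cocircular (hmin : ∀ k ∈ S, X k ∉ cHull (X '' (S \ {k} : Set ι))) {m c : Plane}
    (hm : ∀ k ∈ S, ‖X k - m‖ < 1) {i j k : ι} (hi : i ∈ S) (hj : j ∈ S) (hk : k ∈ S)
    (hij : i ≠ j) (hik : i ≠ k) (hjk : j ≠ k) (hi1 : ‖X i - c‖ = 1) (hj1 : ‖X j - c‖ = 1) :
    ‖X k - c‖ ≠ 1 := by
  intro hk1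
  have hu : ∀ k ∈ S, ‖X k - c‖ = 1 → 0 < (inner ℝ (X k - c) (m - c) : ℝ) := by
    intro k hk hk1
    have h1 := norm_sub_sq_real (X k - c) (m - c)
    rw [sub_sub_sub_cancel_right, hk1] at h1
    have h2 := hm k hk
    rw [← sq_lt_one_iff₀ (norm_nonneg _)] at h2
    nlinarith [sq_nonneg ‖m - c‖]
  rcases three_cocircular hi1 hj1 hk1 (hu i hi hi1) (hu j hj hj1) (hu k hk hk1) with h | h | h
  · exact not_mem_cHull_pair hmin hj hk hi hij.symm hik.symm h
  · exact not_mem_cHull_pair hmin hi hk hj hij hjk.symm h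
  · exact not_mem_cHull_pair hmin hi hj hk hik hjk h

open Classical in
/-- The ordered pairs of points cutting caps off the `c`-hull of a configuration. -/
noncomputable def capPairs (S : Finset ι) (X : ι → Plane) : Finset (ι × ι) :=
  (S ×ˢ S).filter fun e => e.1 ≠ e.2 ∧ ∀ k ∈ S, ‖X k - chordC (X e.1) (X e.2)‖ ≤ 1

lemma mem_capPairs {e : ι × ι} : e ∈ capPairs S X ↔ (e.1 ∈ S ∧ e.2 ∈ S) ∧ e.1 ≠ e.2 ∧
    ∀ k ∈ S, ‖X k - chordC (X e.1) (X e.2)‖ ≤ 1 := by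
  simp [capPairs]

lemma ne_of_minimal (hmin : ∀ k ∈ S, X k ∉ cHull (X '' (S \ {k} : Set ι))) {i j : ι}
    (hi : i ∈ S) (hj : j ∈ S) (hij : i ≠ j) : X i ≠ X j := fun h =>
  not_mem_cHull_pair hmin hj hj hi hij.symm hij.symm (subset_cHull _ (by simp [h]))

lemma norm_sub_lt_two {m : Plane} (hm : ∀ k ∈ S, ‖X k - m‖ < 1) {i j : ι}
    (hi : i ∈ S) (hj : j ∈ S) : ‖X j - X i‖ < 2 := by
  have := norm_sub_le (X j - m) (X i - m)
  rw [sub_sub_sub_cancel_right] at this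
  linarith [hm i hi, hm j hj]

/-- Irredundancy makes the inequalities strict: a third point on the circle, or in the closed cap,
would contradict it. -/
lemma capConfig_capPairs (hmin : ∀ k ∈ S, X k ∉ cHull (X '' (S \ {k} : Set ι))) {m : Plane}
    (hm : ∀ k ∈ S, ‖X k - m‖ < 1) : CapConfig S (capPairs S X) X := by
  intro e he
  obtain ⟨⟨h1, h2⟩, hne, H⟩ := mem_capPairs.1 he
  have hX := ne_of_minimal hmin h1 h2 hne
  have h2' := norm_sub_lt_two hm h1 h2
  refine ⟨h1, h2, hX, h2', fun k hk hk1 hk2 => ⟨?_, ?_⟩⟩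
  · exact lt_of_le_of_ne (H k hk) (three_not_cocircular hmin hm h1 h2 hk hne hk1.symm hk2.symm
      (norm_sub_chordC_left hX h2') (norm_sub_chordC_right hX h2'))
  · by_contra! hcon
    exact not_mem_cHull_pair hmin h1 h2 hk hk1.symm hk2.symm
      (closedCap_subset_cHull hX h2' (H k hk) hcon)

/-- For `z` outside the convex hull, take a separating direction `ν` and the containing unit ball
with lowest centre in that direction. Optimality shows that it touches exactly two points and that
`ν` is in their cone; `z` is in the cap they cut. -/
lemma cHull_subset_convexHull_union (hS : S.Nonempty)
    (hmin : ∀ k ∈ S, X k ∉ cHull (X '' (S \ {k} : Set ι))) {m : Plane}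
    (hm : ∀ k ∈ S, ‖X k - m‖ < 1) :
    cHull (X '' S) ⊆ convexHull ℝ (X '' S) ∪ ⋃ e ∈ capPairs S X, cap (X e.1) (X e.2) := by
  intro z hz
  by_cases hzc : z ∈ convexHull ℝ (X '' (S : Set ι))
  · exact .inl hzc
  right
  obtain ⟨ν, hν, hsep⟩ : ∃ ν : Plane, ‖ν‖ = 1 ∧
      ∀ k ∈ S, (inner ℝ (X k) ν : ℝ) < inner ℝ z ν := by
    obtain ⟨f, u, h1, h2⟩ := geometric_hahn_banach_closed_point (convex_convexHull ℝ _)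
      ((S.finite_toSet.image X).isCompact_convexHull ℝ).isClosed hzc
    set w := (InnerProductSpace.toDual ℝ Plane).symm f
    have hw : ∀ y, f y = inner ℝ w y := fun y => by simp [w]
    have hlt : ∀ k ∈ S, (inner ℝ (X k) w : ℝ) < inner ℝ z w := by
      intro k hk
      rw [real_inner_comm, real_inner_comm w z, ← hw, ← hw]
      exact (h1 _ (subset_convexHull ℝ _ ⟨k, hk, rfl⟩)).trans h2
    have hw0 : w ≠ 0 := by
      intro h0
      obtain ⟨k, hk⟩ := hS
      simpa [h0] using hlt k hk
    have hw1 : 0 < ‖w‖ := norm_pos_iff.2 hw0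
    refine ⟨‖w‖⁻¹ • w, by rw [norm_smul, norm_inv, norm_norm]; field_simp, fun k hk => ?_⟩
    rw [inner_smul_right, inner_smul_right]
    exact mul_lt_mul_of_pos_left (hlt k hk) (inv_pos.2 hw1)
  have hne : (X '' (S : Set ι)).Nonempty := (Finset.coe_nonempty.2 hS).image _
  obtain ⟨c, hc, hcmin⟩ := (isCompact_cDual hne).exists_isMinOn
    ⟨m, mem_cDual.2 (by rintro _ ⟨k, hk, rfl⟩; exact (hm k hk).le)⟩
    (f := fun w => (inner ℝ w ν : ℝ)) (by fun_prop)
  have hzc1 : ‖z - c‖ ≤ 1 := mem_cHull.1 hz c (mem_cDual.1 hc)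
  have hS1 : ∀ k ∈ S, ‖X k - c‖ ≤ 1 := fun k hk => mem_cDual.1 hc _ ⟨k, hk, rfl⟩
  have hopt := fun d : Plane => inner_nonneg_of_isMinOn (d := d) hc hcmin
  have hzν : (inner ℝ z ν : ℝ) - inner ℝ c ν ≤ 1 := by
    rw [← inner_sub_left]
    exact (real_inner_le_norm _ _).trans (by rw [hν, mul_one]; exact hzc1)
  have hact : ∃ i ∈ S, ‖X i - c‖ = 1 := by
    by_contra! h0
    have := hopt (-ν) fun k hk hk1 => absurd hk1 (h0 k hk)
    rw [inner_neg_left, real_inner_self_eq_norm_sq, hν] at this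
    linarith
  obtain ⟨i, hi, hi1⟩ := hact
  have hact2 : ∃ j ∈ S, j ≠ i ∧ ‖X j - c‖ = 1 := by
    by_contra! h0
    -- With a single contact point, optimality tested on `X i - c - ν` forces equality. Then `X i`
    -- is the highest point of the ball, although `z` should be strictly higher.
    have hPν : X i - c = ν := by
      by_contra hPν
      have hlt := (inner_lt_one_iff_real_of_norm_eq_one hi1 hν).2 hPν
      have := hopt (X i - c - ν) fun k hk hk1 => by
        have : k = i := by
          by_contra hki
          exact h0 k hk hki hk1
        subst this
        rw [inner_sub_left, real_inner_self_eq_norm_sq, hk1, real_inner_comm]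
        linarith
      rw [inner_sub_left, real_inner_self_eq_norm_sq, hν] at this
      linarith
    have h1 := hsep i hi
    have h2 : (inner ℝ (X i) ν : ℝ) - inner ℝ c ν = 1 := by
      rw [← inner_sub_left, hPν, real_inner_self_eq_norm_sq, hν]; norm_num
    linarith
  obtain ⟨j, hj, hji, hj1⟩ := hact2
  have hX := ne_of_minimal hmin hi hj hji.symm
  have h2 := norm_sub_lt_two hm hi hj
  -- The two unit vectors are independent: they differ, and they are not antipodal since the points
  -- are at distance less than `2`.
  have hD : (X i - c) 0 * (X j - c) 1 - (X i - c) 1 * (X j - c) 0 ≠ 0 := by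
    intro hD
    have e1 := plane_norm_eq_one.1 hi1
    have e2 := plane_norm_eq_one.1 hj1
    have e3 : (inner ℝ (X i - c) (X j - c) : ℝ) ^ 2 = 1 := by
      rw [plane_inner]
      linear_combination ((X j - c) 0 ^ 2 + (X j - c) 1 ^ 2) * e1 + e2 -
        ((X i - c) 0 * (X j - c) 1 - (X i - c) 1 * (X j - c) 0) * hD
    have e4 := norm_sub_sq_real (X j - c) (X i - c)
    rw [sub_sub_sub_cancel_right, hi1, hj1, real_inner_comm] at e4
    have e5 : 0 < ‖X j - X i‖ := norm_pos_iff.2 (sub_ne_zero.2 hX.symm)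
    rcases (sq_eq_sq_iff_eq_or_eq_neg.1 (e3.trans (one_pow 2).symm)) with h | h <;> nlinarith
  obtain ⟨a, b, ha, hb, hab⟩ := mem_cone_of_dual (ν := ν) hD fun d hdP hdQ =>
    hopt d fun k hk hk1 => by
      by_cases hki : k = i
      · rwa [hki]
      by_cases hkj : k = j
      · rwa [hkj]
      exact absurd hk1 (three_not_cocircular hmin hm hi hj hk hji.symm (Ne.symm hki)
        (Ne.symm hkj) hi1 hj1)
  simp only [Set.mem_iUnion]
  rcases eq_chordC_or hX h2 hi1 hj1 with hcc | hcc
  · refine ⟨(i, j), mem_capPairs.2 ⟨⟨hi, hj⟩, hji.symm, ?_⟩, ?_⟩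
    · rw [hcc] at hS1; exact hS1
    · rw [hcc] at hab hzc1
      exact mem_cap_of_mem_cone hX h2 hν ha hb hab hzc1 (hsep i hi) (hsep j hj)
  · refine ⟨(j, i), mem_capPairs.2 ⟨⟨hj, hi⟩, hji, ?_⟩, ?_⟩
    · rw [hcc] at hS1; exact hS1
    · rw [hcc, add_comm] at hab
      rw [hcc] at hzc1
      exact mem_cap_of_mem_cone hX.symm (by rwa [norm_sub_rev]) hν hb ha hab hzc1
        (hsep j hj) (hsep i hi)

lemma volume_cHull_le (hS : S.Nonempty)
    (hmin : ∀ k ∈ S, X k ∉ cHull (X '' (S \ {k} : Set ι))) {m : Plane}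
    (hm : ∀ k ∈ S, ‖X k - m‖ < 1) :
    volume (cHull (X '' S)) ≤ volume (convexHull ℝ (X '' S)) +
      ∑ e ∈ capPairs S X, capArea (chordH (X e.1) (X e.2)) := by
  refine (measure_mono (cHull_subset_convexHull_union hS hmin hm)).trans
    ((measure_union_le _ _).trans (add_le_add le_rfl ((measure_biUnion_finset_le _ _).trans ?_)))
  refine Finset.sum_le_sum fun e he => ?_
  obtain ⟨-, -, hne, h2, -⟩ := capConfig_capPairs hmin hm e he
  rw [volume_cap hne h2]

end config

/-! ### From local midpoint convexity to convexity. -/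

/-- An upper semicontinuous function that is locally midpoint convex at every interior point lies
below its chord. -/
lemma le_chord_of_local_midpoint {f : ℝ → ℝ} {a b : ℝ} (hab : a < b)
    (hf : UpperSemicontinuousOn f (Set.Icc a b))
    (hmid : ∀ t ∈ Set.Ioo a b, ∀ᶠ ε in 𝓝 (0 : ℝ), 2 * f t ≤ f (t + ε) + f (t - ε))
    {x y : ℝ} (hx : 0 ≤ x) (hy : 0 ≤ y) (hxy : x + y = 1) :
    f (x * a + y * b) ≤ x * f a + y * f b := by
  have hba : b - a ≠ 0 := by linarith
  set l : ℝ → ℝ := fun t => ((b - t) * f a + (t - a) * f b) / (b - a) with hl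
  by_contra! hcon
  set t₁ := x * a + y * b with ht₁
  have ht₁' : t₁ ∈ Set.Icc a b := by
    have : x = 1 - y := by linarith
    subst this
    constructor <;> nlinarith
  have hlt₁ : l t₁ = x * f a + y * f b := by
    have : x = 1 - y := by linarith
    subst this
    simp only [hl, ht₁]; field_simp; ring
  have hg : 0 < f t₁ - l t₁ := by rw [hlt₁]; linarith
  -- A quadratic vanishing at `a` and `b` is added, small enough to keep the excess at `t₁`
  -- positive. At an interior maximum of `G`, its second difference `2 * δ * ε ^ 2` contradicts
  -- midpoint convexity of `f`.
  set δ := (f t₁ - l t₁) / (2 * (b - a) ^ 2) with hδ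
  have hδ0 : 0 < δ := by
    have : 0 < (b - a) ^ 2 := by positivity
    positivity
  set G : ℝ → ℝ := fun t => f t + (δ * ((t - a) * (t - b)) - l t) with hG
  have hGusc : UpperSemicontinuousOn G (Set.Icc a b) := by
    apply hf.add
    exact (Continuous.upperSemicontinuous (by simp only [hl]; fun_prop)).upperSemicontinuousOn _
  have hGt₁ : 0 < G t₁ := by
    have h1 : δ * (b - a) ^ 2 = (f t₁ - l t₁) / 2 := by rw [hδ]; field_simp
    have h2 : (t₁ - a) * (b - t₁) ≤ (b - a) ^ 2 := by
      nlinarith [ht₁'.1, ht₁'.2, mul_nonneg (sub_nonneg.2 ht₁'.1) (sub_nonneg.2 ht₁'.1),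
        mul_nonneg (sub_nonneg.2 ht₁'.1) (sub_nonneg.2 ht₁'.2),
        mul_nonneg (sub_nonneg.2 ht₁'.2) (sub_nonneg.2 ht₁'.2)]
    have h3 := mul_le_mul_of_nonneg_left h2 hδ0.le
    simp only [hG]
    nlinarith
  obtain ⟨s, hs, hsmax⟩ := hGusc.exists_isMaxOn ⟨t₁, ht₁'⟩ isCompact_Icc
  have hGs : 0 < G s := hGt₁.trans_le (hsmax ht₁')
  have hGa : G a = 0 := by simp only [hG, hl]; field_simp; ring
  have hGb : G b = 0 := by simp only [hG, hl]; field_simp; ring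
  have hsa : a < s := lt_of_le_of_ne hs.1 (by rintro rfl; linarith)
  have hsb : s < b := lt_of_le_of_ne hs.2 (by rintro rfl; linarith)
  have h1 : ∀ᶠ ε in 𝓝 (0 : ℝ), s + ε ∈ Set.Icc a b :=
    ContinuousAt.eventually_mem (f := fun ε => s + ε) (by fun_prop)
      (by simpa using Icc_mem_nhds hsa hsb)
  have h2 : ∀ᶠ ε in 𝓝 (0 : ℝ), s - ε ∈ Set.Icc a b :=
    ContinuousAt.eventually_mem (f := fun ε => s - ε) (by fun_prop)
      (by simpa using Icc_mem_nhds hsa hsb)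
  obtain ⟨ε, ⟨e1, e2, e3⟩, e4⟩ := (((hmid s ⟨hsa, hsb⟩).and (h1.and h2)).filter_mono
    (nhdsWithin_le_nhds (s := Set.Ioi 0))).and self_mem_nhdsWithin |>.exists
  have e4 : 0 < ε := e4
  have m1 : G (s + ε) ≤ G s := hsmax e2
  have m2 : G (s - ε) ≤ G s := hsmax e3
  have hll : l (s + ε) + l (s - ε) = 2 * l s := by simp only [hl]; field_simp; ring
  simp only [hG] at m1 m2
  nlinarith [mul_pos hδ0 (mul_pos e4 e4)]

/-! ### Finite moving configurations. -/

section shadow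

variable {ι : Type*}

lemma exists_minimal_config (S : Finset ι) (X : ι → Plane) :
    ∃ T ⊆ S, cDual (X '' T) = cDual (X '' S) ∧
      ∀ k ∈ T, X k ∉ cHull (X '' (T \ {k} : Set ι)) := by
  classical
  induction S using Finset.strongInduction with
  | H S ih =>
    by_cases h : ∀ k ∈ S, X k ∉ cHull (X '' (S \ {k} : Set ι))
    · exact ⟨S, subset_rfl, rfl, h⟩
    · push Not at h
      obtain ⟨k, hk, hkm⟩ := h
      obtain ⟨T, hTS, hT, hT'⟩ := ih (S.erase k) (Finset.erase_ssubset hk)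
      refine ⟨T, hTS.trans (Finset.erase_subset _ _), hT.trans ?_, hT'⟩
      rw [Finset.coe_erase]
      ext d
      rw [mem_cDual, mem_cDual]
      constructor
      · rintro hd _ ⟨i, hi, rfl⟩
        by_cases hik : i = k
        · subst hik; exact mem_cHull.1 hkm d hd
        · exact hd _ ⟨i, ⟨hi, hik⟩, rfl⟩
      · rintro hd _ ⟨i, hi, rfl⟩
        exact hd _ ⟨i, hi.1, rfl⟩

lemma cHull_empty : cHull (∅ : Set Plane) = ∅ := by
  ext z
  simp only [Set.mem_empty_iff_false, iff_false]
  intro hz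
  have := mem_cHull.1 hz (z + !₂[2, 0]) (by simp)
  rw [plane_norm_le_one] at this
  simp at this

/-- The configuration `x` at time `t`, moving along `v` with speeds `α`. -/
def movePt (x : ι → Plane) (α : ι → ℝ) (v : Plane) (t : ℝ) (i : ι) : Plane :=
  x i + (t * α i) • v

variable (S : Finset ι) (x : ι → Plane) (α : ι → ℝ) {v : Plane}

lemma volume_cHull_local_midpoint (hv : ‖v‖ = 1) {t : ℝ} {d d' : Plane}
    (hd : d ∈ cDual (movePt x α v t '' S)) (hd' : d' ∈ cDual (movePt x α v t '' S))
    (hne : d ≠ d') :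
    ∀ᶠ ε in 𝓝 (0 : ℝ), 2 * volume (cHull (movePt x α v t '' S)) ≤
      volume (cHull (movePt x α v (t + ε) '' S)) + volume (cHull (movePt x α v (t - ε) '' S)) := by
  obtain ⟨T, hTS, hT, hmin⟩ := exists_minimal_config S (movePt x α v t)
  rw [← hT] at hd hd'
  rw [cHull, ← hT, ← cHull]
  rcases T.eq_empty_or_nonempty with rfl | hTne
  · simp [cHull_empty]
  obtain ⟨m, hm⟩ := exists_norm_sub_lt_one hd hd' hne
  have hm : ∀ k ∈ T, ‖movePt x α v t k - m‖ < 1 := fun k hk => hm _ ⟨k, hk, rfl⟩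
  have hconf := capConfig_capPairs hmin hm
  have hup := volume_cHull_le hTne hmin hm
  set E := capPairs T (movePt x α v t)
  have c1 : ∀ᶠ ε in 𝓝 (0 : ℝ), CapConfig T E (movePt x α v (t + ε)) :=
    CapConfig.eventually (X := fun ε => movePt x α v (t + ε))
      (fun i => by unfold movePt; fun_prop) (by simpa using hconf)
  have c2 : ∀ᶠ ε in 𝓝 (0 : ℝ), CapConfig T E (movePt x α v (t - ε)) :=
    CapConfig.eventually (X := fun ε => movePt x α v (t - ε))
      (fun i => by unfold movePt; fun_prop) (by simpa using hconf)
  filter_upwards [c1, c2] with ε c1 c2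
  have e1 : movePt x α v (t + ε) = fun i => movePt x α v t i + (ε * α i) • v := by
    funext i; unfold movePt; module
  have e2 : movePt x α v (t - ε) = fun i => movePt x α v t i - (ε * α i) • v := by
    funext i; unfold movePt; module
  have hconv := volume_convexHull_midpoint T (movePt x α v t) (fun i => ε * α i) hv
  rw [← e1, ← e2] at hconv
  have hcap : ∀ e ∈ E, 2 * capArea (chordH (movePt x α v t e.1) (movePt x α v t e.2)) ≤
      capArea (chordH (movePt x α v (t + ε) e.1) (movePt x α v (t + ε) e.2)) +
      capArea (chordH (movePt x α v (t - ε) e.1) (movePt x α v (t - ε) e.2)) := by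
    intro e he
    obtain ⟨-, -, -, h1, -⟩ := c1 e he
    obtain ⟨-, -, -, h2, -⟩ := c2 e he
    apply capArea_midpoint
    set u : Plane := (ε * (α e.2 - α e.1)) • v
    have f1 : movePt x α v (t + ε) e.2 - movePt x α v (t + ε) e.1 =
        movePt x α v t e.2 + u - movePt x α v t e.1 := by
      simp only [e1, u]; module
    have f2 : movePt x α v (t - ε) e.2 - movePt x α v (t - ε) e.1 =
        movePt x α v t e.2 - u - movePt x α v t e.1 := by
      simp only [e2, u]; module
    rw [f1] at h1
    rw [f2] at h2
    unfold chordH chordR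
    rw [f1, f2]
    exact chordH_midpoint h1 h2
  calc 2 * volume (cHull (movePt x α v t '' T))
      ≤ 2 * (volume (convexHull ℝ (movePt x α v t '' T)) +
        ∑ e ∈ E, capArea (chordH (movePt x α v t e.1) (movePt x α v t e.2))) := by gcongr
    _ = 2 * volume (convexHull ℝ (movePt x α v t '' T)) +
        ∑ e ∈ E, 2 * capArea (chordH (movePt x α v t e.1) (movePt x α v t e.2)) := by
      rw [mul_add, Finset.mul_sum]
    _ ≤ (volume (convexHull ℝ (movePt x α v (t + ε) '' T)) +
          volume (convexHull ℝ (movePt x α v (t - ε) '' T))) +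
        ∑ e ∈ E, (capArea (chordH (movePt x α v (t + ε) e.1) (movePt x α v (t + ε) e.2)) +
          capArea (chordH (movePt x α v (t - ε) e.1) (movePt x α v (t - ε) e.2))) :=
      add_le_add hconv (Finset.sum_le_sum hcap)
    _ ≤ volume (cHull (movePt x α v (t + ε) '' T)) + volume (cHull (movePt x α v (t - ε) '' T)) := by
      rw [Finset.sum_add_distrib, add_add_add_comm]
      exact add_le_add c1.volume_le c2.volume_le
    _ ≤ _ := by
      gcongr <;> exact cHull_mono (Set.image_mono (Finset.coe_subset.2 hTS))

lemma mem_cDual_movePt {a b s t : ℝ} (hs : 0 ≤ s) (ht : 0 ≤ t) (hst : s + t = 1) {c d : Plane}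
    (hc : c ∈ cDual (movePt x α v a '' S)) (hd : d ∈ cDual (movePt x α v b '' S)) :
    s • c + t • d ∈ cDual (movePt x α v (s * a + t * b) '' S) := by
  rw [mem_cDual] at *
  rintro _ ⟨i, hi, rfl⟩
  have h1 := hc _ ⟨i, hi, rfl⟩
  have h2 := hd _ ⟨i, hi, rfl⟩
  have e : movePt x α v (s * a + t * b) i - (s • c + t • d) =
      s • (movePt x α v a i - c) + t • (movePt x α v b i - d) := by
    have : s = 1 - t := by linarith
    subst this
    unfold movePt; module
  rw [e]
  refine (norm_add_le _ _).trans ?_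
  rw [norm_smul, norm_smul, Real.norm_of_nonneg hs, Real.norm_of_nonneg ht]
  nlinarith

/-- Each centre `c` at time `a` averages with `d` to a centre at the intermediate time, at distance
`t * ‖d - c‖` from `c`. -/
lemma cHull_movePt_subset {a b s t η : ℝ} (hs : 0 ≤ s) (ht : 0 ≤ t) (hst : s + t = 1) {d : Plane}
    (hd : d ∈ cDual (movePt x α v b '' S))
    (hη : ∀ c ∈ cDual (movePt x α v a '' S), t * ‖d - c‖ ≤ η) :
    cHull (movePt x α v (s * a + t * b) '' S) ⊆
      ⋂ c ∈ cDual (movePt x α v a '' S), Metric.closedBall c (1 + η) := by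
  intro z hz
  simp only [Set.mem_iInter, mem_closedBall_iff_norm]
  intro c hc
  have h1 := mem_cHull.1 hz _ (mem_cDual.1 (mem_cDual_movePt S x α hs ht hst hc hd))
  have e : z - c = (z - (s • c + t • d)) + t • (d - c) := by
    have : s = 1 - t := by linarith
    subst this
    module
  rw [e]
  refine (norm_add_le _ _).trans ?_
  rw [norm_smul, Real.norm_of_nonneg ht]
  linarith [hη c hc]

lemma eventually_cHull_movePt_subset {i : ι} (hi : i ∈ S) {a b η : ℝ} (hη : 0 < η) {d : Plane}
    (hd : d ∈ cDual (movePt x α v b '' S)) :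
    ∀ᶠ r in 𝓝 a, r ∈ segment ℝ a b → cHull (movePt x α v r '' S) ⊆
      ⋂ c ∈ cDual (movePt x α v a '' S), Metric.closedBall c (1 + η) := by
  by_cases hab : a = b
  · subst hab
    refine Eventually.of_forall fun r hr => ?_
    rw [segment_same, Set.mem_singleton_iff] at hr
    have := cHull_movePt_subset (a := a) (b := a) (s := 1) (t := 0) (η := η) S x α zero_le_one
      le_rfl (by norm_num) hd (by intro c _; simpa using hη.le)
    simpa [hr] using this
  -- Every centre `c` at time `a` is within `1` of the point `i`, so `K` bounds `‖d - c‖` uniformly.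
  set K := 1 + ‖movePt x α v a i - d‖
  have hcont : ContinuousAt (fun r : ℝ => |r - a| * K) a := by fun_prop
  have hlt := hcont.eventually_lt (continuousAt_const (y := η * |b - a|))
    (by simpa using mul_pos hη (abs_pos.2 (sub_ne_zero.2 (Ne.symm hab))))
  filter_upwards [hlt] with r hr hseg
  obtain ⟨s, t, hs, ht, hst, rfl⟩ := hseg
  simp only [smul_eq_mul] at hr ⊢
  refine cHull_movePt_subset S x α hs ht hst hd fun c hc => ?_
  have h1 := mem_cDual.1 hc _ ⟨i, hi, rfl⟩
  have h2 : ‖d - c‖ ≤ K := by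
    have := norm_sub_le (movePt x α v a i - c) (movePt x α v a i - d)
    have e : movePt x α v a i - c - (movePt x α v a i - d) = d - c := by module
    rw [e] at this
    linarith
  have e : s * a + t * b - a = t * (b - a) := by
    have : s = 1 - t := by linarith
    subst this
    ring
  rw [e, abs_mul, abs_of_nonneg ht] at hr
  have h3 : 0 < |b - a| := abs_pos.2 (sub_ne_zero.2 (Ne.symm hab))
  have h4 : t * K < η := by nlinarith
  exact (mul_le_mul_of_nonneg_left h2 ht).trans h4.le

lemma volume_cHull_lt_top {A : Set Plane} {d : Plane} (hd : d ∈ cDual A) :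
    volume (cHull A) < ⊤ :=
  (measure_mono (cHull_subset_closedBall hd)).trans_lt measure_closedBall_lt_top

lemma cDual_nonempty_of_volume_ne_top {A : Set Plane} (h : volume (cHull A) ≠ ⊤) :
    (cDual A).Nonempty := by
  by_contra hne
  rw [Set.not_nonempty_iff_eq_empty] at hne
  apply h
  rw [cHull, hne]
  simp [cDual]

/-- Upper semicontinuity: nearby hulls lie in the sets `N η`, which have finite area for small `η`
and decrease to the hull at time `t`. -/
lemma eventually_volume_cHull_lt {i : ι} (hi : i ∈ S) {a b t : ℝ} (ht : t ∈ Set.Icc a b)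
    {da db dt : Plane} (hda : da ∈ cDual (movePt x α v a '' S))
    (hdb : db ∈ cDual (movePt x α v b '' S)) (hdt : dt ∈ cDual (movePt x α v t '' S)) {y : ℝ≥0∞}
    (hy : volume (cHull (movePt x α v t '' S)) < y) :
    ∀ᶠ r in 𝓝[Set.Icc a b] t, volume (cHull (movePt x α v r '' S)) < y := by
  set C := cDual (movePt x α v t '' (S : Set ι))
  set N : ℝ → Set Plane := fun η => ⋂ c ∈ C, Metric.closedBall c (1 + η)
  have hcl : ∀ η, IsClosed (N η) := fun η => isClosed_biInter fun _ _ => Metric.isClosed_closedBall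
  have hN : (⋂ η > 0, N η) = cHull (movePt x α v t '' S) := by
    ext z
    simp only [N, Set.mem_iInter, mem_closedBall_iff_norm, mem_cHull]
    constructor
    · intro h c hc
      exact le_of_forall_pos_le_add fun η hη => h η hη c (mem_cDual.2 hc)
    · intro h η hη c hc
      linarith [h c (mem_cDual.1 hc)]
  have hlim := tendsto_measure_biInter_gt (μ := (volume : Measure Plane)) (s := N) (a := 0)
    (fun r _ => (hcl r).measurableSet.nullMeasurableSet)
    (fun r s _ hrs => Set.iInter₂_mono fun c _ => Metric.closedBall_subset_closedBall (by linarith))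
    ⟨1, one_pos, ((measure_mono (Set.biInter_subset_of_mem hdt)).trans_lt
      measure_closedBall_lt_top).ne⟩
  rw [hN] at hlim
  obtain ⟨η, hη, hη0⟩ := ((hlim.eventually (gt_mem_nhds hy)).and self_mem_nhdsWithin).exists
  have hη0 : 0 < η := hη0
  filter_upwards [nhdsWithin_le_nhds (eventually_cHull_movePt_subset (a := t) S x α hi hη0 hda),
    nhdsWithin_le_nhds (eventually_cHull_movePt_subset (a := t) S x α hi hη0 hdb),
    self_mem_nhdsWithin] with r h1 h2 hr
  refine lt_of_le_of_lt (measure_mono ?_) hη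
  rcases le_total r t with h | h
  · exact h1 (by rw [segment_symm, segment_eq_Icc ht.1]; exact ⟨hr.1, h⟩)
  · exact h2 (by rw [segment_eq_Icc ht.2]; exact ⟨h, hr.2⟩)

lemma cHull_eq_closedBall {A : Set Plane} {d : Plane} (hd : d ∈ cDual A)
    (hs : (cDual A).Subsingleton) : cHull A = Metric.closedBall d 1 := by
  rw [cHull, hs.eq_singleton_of_mem hd]
  simp [cDual]

lemma volume_cHull_finset_le (hv : ‖v‖ = 1) {a b : ℝ} (hab : a < b) {s t : ℝ≥0}
    (hst : s + t = 1) :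
    volume (cHull (movePt x α v (s * a + t * b) '' S)) ≤
      s * volume (cHull (movePt x α v a '' S)) + t * volume (cHull (movePt x α v b '' S)) := by
  rcases eq_or_ne s 0 with rfl | hs0
  · rw [zero_add] at hst; subst hst; simp
  rcases eq_or_ne t 0 with rfl | ht0
  · rw [add_zero] at hst; subst hst; simp
  rcases S.eq_empty_or_nonempty with rfl | ⟨i, hi⟩
  · simp [cHull_empty]
  rcases eq_or_ne (volume (cHull (movePt x α v a '' S))) ⊤ with hFa | hFa
  · rw [hFa, ENNReal.mul_top (by simpa using hs0)]; simp
  rcases eq_or_ne (volume (cHull (movePt x α v b '' S))) ⊤ with hFb | hFb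
  · rw [hFb, ENNReal.mul_top (by simpa using ht0)]; simp
  obtain ⟨da, hda⟩ := cDual_nonempty_of_volume_ne_top hFa
  obtain ⟨db, hdb⟩ := cDual_nonempty_of_volume_ne_top hFb
  have hst' : (s : ℝ) + t = 1 := by exact_mod_cast hst
  have hC : ∀ r ∈ Set.Icc a b, (cDual (movePt x α v r '' S)).Nonempty := by
    intro r hr
    rw [← segment_eq_Icc hab.le] at hr
    obtain ⟨p, q, hp, hq, hpq, rfl⟩ := hr
    exact ⟨_, mem_cDual_movePt S x α hp hq hpq hda hdb⟩
  -- Averaging with a fixed centre at the other end is injective, so uniqueness of the centre at an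
  -- interior time passes to both ends.
  by_cases hsing : ∃ r ∈ Set.Ioo a b, (cDual (movePt x α v r '' (S : Set ι))).Subsingleton
  · obtain ⟨r, hr, hsub⟩ := hsing
    rw [← openSegment_eq_Ioo hab] at hr
    obtain ⟨p, q, hp, hq, hpq, rfl⟩ := hr
    have sa : (cDual (movePt x α v a '' (S : Set ι))).Subsingleton := by
      intro c hc c' hc'
      have := hsub (mem_cDual_movePt S x α hp.le hq.le hpq hc hdb)
        (mem_cDual_movePt S x α hp.le hq.le hpq hc' hdb)
      exact smul_right_injective _ hp.ne' (add_right_cancel this)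
    have sb : (cDual (movePt x α v b '' (S : Set ι))).Subsingleton := by
      intro c hc c' hc'
      have := hsub (mem_cDual_movePt S x α hp.le hq.le hpq hda hc)
        (mem_cDual_movePt S x α hp.le hq.le hpq hda hc')
      exact smul_right_injective _ hq.ne' (add_left_cancel this)
    rw [cHull_eq_closedBall hda sa, cHull_eq_closedBall hdb sb]
    refine (measure_mono (cHull_subset_closedBall (mem_cDual_movePt S x α s.2 t.2 hst' hda
      hdb))).trans ?_
    rw [Measure.addHaar_closedBall_center, Measure.addHaar_closedBall_center _ da,
      Measure.addHaar_closedBall_center _ db, ← add_mul]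
    rw [← ENNReal.coe_add, hst, ENNReal.coe_one, one_mul]
  push Not at hsing
  have hfin : ∀ r ∈ Set.Icc a b, volume (cHull (movePt x α v r '' S)) ≠ ⊤ := fun r hr =>
    (volume_cHull_lt_top (hC r hr).some_mem).ne
  set f : ℝ → ℝ := fun r => (volume (cHull (movePt x α v r '' S))).toReal
  have key : f (s * a + t * b) ≤ s * f a + t * f b := by
    refine le_chord_of_local_midpoint hab ?_ ?_ s.2 t.2 hst'
    · intro r hr y hy
      have hy0 : 0 < y := ENNReal.toReal_nonneg.trans_lt hy
      have := eventually_volume_cHull_lt S x α hi hr hda hdb (hC r hr).some_mem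
        ((ENNReal.lt_ofReal_iff_toReal_lt (hfin r hr)).2 hy)
      filter_upwards [this] with r' h'
      exact (ENNReal.lt_ofReal_iff_toReal_lt h'.ne_top).1 h'
    · intro r hr
      obtain ⟨d, hd, d', hd', hne⟩ := hsing r hr
      have h1 : ∀ᶠ ε in 𝓝 (0 : ℝ), r + ε ∈ Set.Icc a b :=
        ContinuousAt.eventually_mem (f := fun ε => r + ε) (by fun_prop)
          (by simpa using Icc_mem_nhds hr.1 hr.2)
      have h2 : ∀ᶠ ε in 𝓝 (0 : ℝ), r - ε ∈ Set.Icc a b :=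
        ContinuousAt.eventually_mem (f := fun ε => r - ε) (by fun_prop)
          (by simpa using Icc_mem_nhds hr.1 hr.2)
      filter_upwards [volume_cHull_local_midpoint S x α hv hd hd' hne, h1, h2] with ε h0 h1 h2
      have := ENNReal.toReal_mono (ENNReal.add_ne_top.2 ⟨hfin _ h1, hfin _ h2⟩) h0
      rwa [ENNReal.toReal_mul, ENNReal.toReal_add (hfin _ h1) (hfin _ h2)] at this
  have hmem : (s * a + t * b : ℝ) ∈ Set.Icc a b := by
    rw [← segment_eq_Icc hab.le]
    exact ⟨s, t, s.2, t.2, hst', rfl⟩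
  rw [← ENNReal.toReal_le_toReal (hfin _ hmem) (by finiteness),
    ENNReal.toReal_add (by finiteness) (by finiteness), ENNReal.toReal_mul, ENNReal.toReal_mul]
  exact key

end shadow

/-! ### Arbitrary families of moving points. -/

/-- The area of a `c`-hull is the supremum of the areas of the `c`-hulls of finite subsets. -/
lemma volume_cHull_range_le {ι : Type*} (X : ι → Plane) {B : ℝ≥0∞}
    (hB : ∀ S : Finset ι, volume (cHull (X '' S)) ≤ B) : volume (cHull (Set.range X)) ≤ B := by
  rcases isEmpty_or_nonempty ι with hι | ⟨⟨i₀⟩⟩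
  · simpa [Set.range_eq_empty] using hB ∅
  set L := cHull (Set.range X)
  have hL : volume L ≤ volume (interior L) := by
    have h1 : volume (frontier L) = 0 := (convex_cDual _ : Convex ℝ L).addHaar_frontier volume
    calc volume L ≤ volume (interior L ∪ frontier L) := by
          rw [← closure_eq_interior_union_frontier]; exact measure_mono subset_closure
      _ ≤ _ := (measure_union_le _ _).trans (by rw [h1, add_zero])
  refine hL.trans ?_
  rw [isOpen_interior.measure_eq_iSup_isCompact]
  refine iSup₂_le fun K hKL => iSup_le fun hK => ?_
  -- `W` pairs points of `K` with candidate centres not containing them in their open ball. As `K`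
  -- is interior to the hull, each such centre is strictly violated by some `X i`, and finitely many
  -- `i` suffice; adding `i₀` confines the centres to a compact ball.
  set W : Set (Plane × Plane) := (K ×ˢ Metric.closedBall (X i₀) 1) ∩ {w | 1 ≤ ‖w.1 - w.2‖}
  have hW : IsCompact W := (hK.prod (isCompact_closedBall _ _)).inter_right
    (isClosed_le (by fun_prop) (by fun_prop))
  obtain ⟨T, hT⟩ := hW.elim_finite_subcover (fun i => {w : Plane × Plane | 1 < ‖X i - w.2‖})
    (fun i => isOpen_lt (by fun_prop) (by fun_prop)) (by
      rintro ⟨z, c⟩ ⟨⟨hz, -⟩, hzc⟩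
      by_contra hcon
      simp only [Set.mem_iUnion, not_exists, Set.mem_ofPred_eq, not_lt] at hcon hzc
      have hc : c ∈ cDual (Set.range X) := mem_cDual.2 (by rintro _ ⟨i, rfl⟩; exact hcon i)
      have h1 := interior_mono (cHull_subset_closedBall hc) (hKL hz)
      rw [interior_closedBall _ one_ne_zero, mem_ball_iff_norm] at h1
      exact h1.not_ge hzc)
  classical
  refine (measure_mono ?_).trans (hB (insert i₀ T))
  intro z hz
  refine mem_cHull.2 fun c hc => ?_
  by_contra! hcon
  have h0 := hc _ ⟨i₀, by simp, rfl⟩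
  have := hT (show (z, c) ∈ W from ⟨⟨hz, by rwa [mem_closedBall_iff_norm, norm_sub_rev]⟩, hcon.le⟩)
  simp only [Set.mem_iUnion, Set.mem_ofPred_eq] at this
  obtain ⟨i, hi, hi1⟩ := this
  exact (hc _ ⟨i, by simp [hi], rfl⟩).not_gt hi1

/-- The area of the `c`-hull of points moving along a common direction is a convex function of
time. -/
theorem convexOn_volume_cHull_range {ι : Type*} (x : ι → Plane) (α : ι → ℝ) {v : Plane}
    (hv : ‖v‖ = 1) :
    ConvexOn ℝ≥0 Set.univ fun t : ℝ => volume (cHull (Set.range (movePt x α v t))) := by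
  refine ⟨convex_univ, fun a _ b _ s t _ _ hst => ?_⟩
  have main : ∀ {a b : ℝ} {s t : ℝ≥0}, a < b → s + t = 1 →
      volume (cHull (Set.range (movePt x α v (s * a + t * b)))) ≤
        s * volume (cHull (Set.range (movePt x α v a))) +
          t * volume (cHull (Set.range (movePt x α v b))) := fun hab hst =>
    volume_cHull_range_le _ fun S => (volume_cHull_finset_le S x α hv hab hst).trans (by
      gcongr <;> exact cHull_mono (Set.image_subset_range _ _))
  simp only [NNReal.smul_def, ENNReal.smul_def, smul_eq_mul]
  rcases lt_trichotomy a b with hab | rfl | hab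
  · exact main hab hst
  · rw [← add_mul, ← add_mul, ← ENNReal.coe_add, ← NNReal.coe_add, hst]; simp
  · have := main hab ((add_comm t s).trans hst)
    rwa [add_comm (t * b : ℝ), add_comm (t * volume _)] at this

theorem mainTheorem7 :
    (∀ v : EuclideanSpace ℝ (Fin 2), ‖v‖ = 1 →
      ∀ (m : ℕ) (x : Fin m → EuclideanSpace ℝ (Fin 2)) (α : Fin m → ℝ),
        ConvexOn ℝ≥0 Set.univ
          (fun t : ℝ => MeasureTheory.volume (cHull {p | ∃ i : Fin m, p = x i + (t * α i) • v})))
    ∧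
    (∀ v : EuclideanSpace ℝ (Fin 2), ‖v‖ = 1 →
      ∀ A : Set (EuclideanSpace ℝ (Fin 2)), Bornology.IsBounded A →
      ∀ α : A → ℝ,
        ConvexOn ℝ≥0 Set.univ
          (fun t : ℝ => MeasureTheory.volume
            (cHull {p | ∃ a : A, p = (a : EuclideanSpace ℝ (Fin 2)) + (t * α a) • v}))) := by
  have e : ∀ {ι : Type} (x : ι → Plane) (α : ι → ℝ) (v : Plane) (t : ℝ),
      {p | ∃ i, p = x i + (t * α i) • v} = Set.range (movePt x α v t) := fun x α v t => by
    ext p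
    simp only [Set.mem_ofPred_eq, Set.mem_range, movePt, eq_comm]
  refine ⟨fun v hv m x α => ?_, fun v hv A _ α => ?_⟩
  · simp only [e]
    exact convexOn_volume_cHull_range x α hv
  · simp only [e (fun a : A => (a : Plane))]
    exact convexOn_volume_cHull_range (fun a : A => (a : Plane)) α hv
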